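/- Double categories, double functors and natural transformations are taken in the usual sense: a (pseudo) double category $\mathbb D$ has objects, arrows $f\colon x\to y$ (forming a category), proarrows $m\colon x\nrightarrow y$, and cells; internal composition of cells (written $\cdot$) is strict and external composition $\odot$ (written in diagrammatic order, with identities $\mathrm{id}_x$, $\mathrm{id}_f$) is associative and unital up to coherent invertible globular cells; double functors are pseudo. Its underlying bicategory $\mathbf D$ has the objects, proarrows and globular cells of $\mathbb D$, and a double functor $F$ induces a pseudofunctor, again denoted $F$, between underlying bicategories. A double adjunction $(\eta,\varepsilon)\colon F\dashv G\colon \mathbb D\rightleftarrows\mathbb E$ between pseudo double functors consists of natural transformations $\eta\colon 1_{\mathbb D}\Rightarrow G\circ F$ and $\varepsilon\colon F\circ G\Rightarrow 1_{\mathbb E}$ (with component arrows at objects and component cells at proarrows) satisfying the triangle identities strictly. A companion of an arrow $f\colon x\to y$ is a proarrow $f_!\colon x\nrightarrow y$ with cells $u\colon \mathrm{id}_x\to f_!$ (source arrow $1_x$, target arrow $f$) and $c\colon f_!\to \mathrm{id}_y$ (source arrow $f$, target arrow $1_y$) such that $u\odot c=1_{f_!}$ modulo unitors and $u\cdot c=\mathrm{id}_f$.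 If $f\colon x\to w$ and $g\colon y\to z$ have companions, a cell $\alpha$ from $m\colon x\nrightarrow y$ to $n\colon w\nrightarrow z$ with source $f$ and target $g$ gives the globular cell $\alpha_!\colon m\odot g_!\to f_!\odot n$, namely $u_f\odot\alpha\odot c_g$ modulo unitors; $\alpha$ is a commuter if $\alpha_!$ is invertible. A lax adjunction $(\eta,\theta,s,t)\colon F\dashv G\colon \mathbf B\rightleftarrows\mathbf C$ between pseudofunctors consists here of oplax natural transformations $\eta\colon 1\to GF$ and $\theta\colon FG\to 1$ (with comparisons $\eta_m\colon m\odot\eta_y\to\eta_x\odot GFm$ for $m\colon x\to y$ in $\mathbf B$, and $\theta_n\colon FGn\odot\theta_z\to\theta_y\odot n$ for $n\colon y\to z$ in $\mathbf C$) and invertible modifications $s\colon 1_F\cong (F*\eta)\odot(\theta*F)$ and $t\colon(\eta*G)\odot(G*\theta)\cong 1_G$ satisfying the two swallowtail identities: modulo structural isomorphisms, for every object $x$ of $\mathbf B$ the composite $$\eta_x\xrightarrow{\;t_{Fx}^{-1}\;}\eta_x\odot\eta_{GFx}\odot G\theta_{Fx}\xrightarrow{\;\eta_{\eta_x}\;}\eta_x\odot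 GF\eta_x\odot G\theta_{Fx}\xrightarrow{\;Gs_x^{-1}\;}\eta_x$$ is the identity, and for every object $y$ of $\mathbf C$ the composite $$\theta_y\xrightarrow{\;Ft_y^{-1}\;}F\eta_{Gy}\odot FG\theta_y\odot\theta_y\xrightarrow{\;\theta_{\theta_y}\;}F\eta_{Gy}\odot\theta_{FGy}\odot\theta_y\xrightarrow{\;s_{Gy}^{-1}\;}\theta_y$$ is the identity. It is a biadjunction if moreover $\eta$ and $\theta$ are pseudo natural, i.e. all their comparisons are invertible. **Statement.** Let $(\eta,\varepsilon)\colon F\dashv G\colon\mathbb D\rightleftarrows\mathbb E$ be a double adjunction between pseudo double functors such that every component arrow $\eta_x$ and $\varepsilon_y$ has a companion, and choose such companions. Then there is a lax adjunction $(\eta_!,\varepsilon_!,s,t)\colon F\dashv G\colon\mathbf D\rightleftarrows\mathbf E$ between the underlying bicategories, comprising the underlying pseudofunctors, oplax natural transformations and invertible modifications. Here $\eta_!$ has components the chosen companions $(\eta_x)_!$ and comparisons $(\eta_!)_m=(\eta_m)_!$ obtained from the component cells $\eta_m$, and likewise for $\varepsilon_!$. If, moreover, all component cells of $\eta$ and of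 $\varepsilon$ are commuters, then $\eta_!$ and $\varepsilon_!$ are pseudo natural, so this lax adjunction is a biadjunction comprising pseudofunctors, pseudo natural transformations and invertible modifications. -/

import Mathlib

open CategoryTheory Bicategory

universe c p v u c₁ p₁ v₁ u₁ c₂ p₂ v₂ u₂ c₃ p₃ v₃ u₃

/-! ## Double categories -/

set_option linter.checkUnivs false in
/-- Objects and arrows forming a category, proarrows, and cells. A cell `α : Cell m n` has a
source arrow `src α` and a target arrow `tgt α`, so it is a square
```
      x --m--> y
      |        |
 src α|   α    | tgt α
      v        v
      w --n--> z
```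
Cells are the morphisms of a category with respect to internal (vertical) composition, on which
`src` and `tgt` are functors to the category of objects and arrows. -/
class CellCategory (D : Type u) extends Category.{v} D where
  /-- proarrows -/
  Pro : D → D → Type p
  /-- cells with a given top and bottom proarrow -/
  Cell : {x y w z : D} → Pro x y → Pro w z → Type c
  /-- the left-hand boundary arrow of a cell -/
  src : {x y w z : D} → {m : Pro x y} → {n : Pro w z} → Cell m n → (x ⟶ w)
  /-- the right-hand boundary arrow of a cell -/
  tgt : {x y w z : D} → {m : Pro x y} → {n : Pro w z} → Cell m n → (y ⟶ z)
  /-- internal identity cell `1_m` -/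
  vid : {x y : D} → (m : Pro x y) → Cell m m
  /-- internal composition of cells -/
  vcomp : {x y w z a b : D} → {m : Pro x y} → {n : Pro w z} → {k : Pro a b} →
    Cell m n → Cell n k → Cell m k
  src_vid : ∀ {x y : D} (m : Pro x y), src (vid m) = 𝟙 x
  tgt_vid : ∀ {x y : D} (m : Pro x y), tgt (vid m) = 𝟙 y
  src_vcomp : ∀ {x y w z a b : D} {m : Pro x y} {n : Pro w z} {k : Pro a b}
    (α : Cell m n) (β : Cell n k), src (vcomp α β) = src α ≫ src β
  tgt_vcomp : ∀ {x y w z a b : D} {m : Pro x y} {n : Pro w z} {k : Pro a b}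
    (α : Cell m n) (β : Cell n k), tgt (vcomp α β) = tgt α ≫ tgt β
  vid_vcomp : ∀ {x y w z : D} {m : Pro x y} {n : Pro w z} (α : Cell m n), vcomp (vid m) α = α
  vcomp_vid : ∀ {x y w z : D} {m : Pro x y} {n : Pro w z} (α : Cell m n), vcomp α (vid n) = α
  vcomp_assoc : ∀ {x y w z a b a' b' : D} {m : Pro x y} {n : Pro w z} {k : Pro a b}
    {l : Pro a' b'} (α : Cell m n) (β : Cell n k) (γ : Cell k l),
    vcomp (vcomp α β) γ = vcomp α (vcomp β γ)

namespace CellCategory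

attribute [simp] src_vid tgt_vid src_vcomp tgt_vcomp vid_vcomp vcomp_vid vcomp_assoc

/-- internal composition of cells, in diagrammatic order -/
infixr:80 " ⋆ " => CellCategory.vcomp

variable {D : Type u} [CellCategory.{c, p, v} D]

/-- A globular cell: a cell whose source and target arrows are identities. -/
@[ext] structure Globular {x y : D} (m n : Pro x y) where
  /-- the underlying cell -/
  cell : Cell m n
  src_cell : src cell = 𝟙 x
  tgt_cell : tgt cell = 𝟙 y

attribute [simp] Globular.src_cell Globular.tgt_cell

/-- Proarrows `x ⇸ y` and globular cells form a category. -/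
instance globularCategory (x y : D) : Category (Pro x y) where
  Hom m n := Globular m n
  id m := ⟨vid m, by simp, by simp⟩
  comp α β := ⟨α.cell ⋆ β.cell, by simp, by simp⟩
  id_comp α := Globular.ext (by simp)
  comp_id α := Globular.ext (by simp)
  assoc α β γ := Globular.ext (by simp)

/-- the underlying cell of a globular cell -/
abbrev cellOf {x y : D} {m n : Pro x y} (α : m ⟶ n) : Cell m n := Globular.cell α

@[ext] theorem glob_ext {x y : D} {m n : Pro x y} {α β : m ⟶ n} (h : cellOf α = cellOf β) :
    α = β := Globular.ext h

@[simp] theorem cellOf_id {x y : D} (m : Pro x y) : cellOf (𝟙 m) = vid m := rfl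

@[simp] theorem cellOf_comp {x y : D} {m n k : Pro x y} (α : m ⟶ n) (β : n ⟶ k) :
    cellOf (α ≫ β) = cellOf α ⋆ cellOf β := rfl

@[simp] theorem src_cellOf {x y : D} {m n : Pro x y} (α : m ⟶ n) : src (cellOf α) = 𝟙 x :=
  Globular.src_cell α

@[simp] theorem tgt_cellOf {x y : D} {m n : Pro x y} (α : m ⟶ n) : tgt (cellOf α) = 𝟙 y :=
  Globular.tgt_cell α

@[simp] theorem hom_vcomp_inv {x y : D} {m n : Pro x y} (e : m ≅ n) :
    cellOf e.hom ⋆ cellOf e.inv = vid m := by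
  rw [← cellOf_comp, e.hom_inv_id, cellOf_id]

@[simp] theorem inv_vcomp_hom {x y : D} {m n : Pro x y} (e : m ≅ n) :
    cellOf e.inv ⋆ cellOf e.hom = vid n := by
  rw [← cellOf_comp, e.inv_hom_id, cellOf_id]

@[simp] theorem hom_vcomp_inv_assoc {x y w z : D} {m n : Pro x y} {k : Pro w z} (e : m ≅ n)
    (α : Cell m k) : cellOf e.hom ⋆ cellOf e.inv ⋆ α = α := by
  rw [← vcomp_assoc, hom_vcomp_inv, vid_vcomp]

@[simp] theorem inv_vcomp_hom_assoc {x y w z : D} {m n : Pro x y} {k : Pro w z} (e : m ≅ n)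
    (α : Cell n k) : cellOf e.inv ⋆ cellOf e.hom ⋆ α = α := by
  rw [← vcomp_assoc, inv_vcomp_hom, vid_vcomp]

end CellCategory

open CellCategory

set_option linter.checkUnivs false in
/-- A (pseudo) double category: external composition of proarrows and cells is associative and
unital up to coherent natural globular isomorphisms. The external composite `hcell α β h` of two
cells is defined when the target arrow of `α` is the source arrow of `β`. In the axioms, the
proofs `h` of composability are arguments; they can always be supplied from the equations for
sources and targets. -/
class DoubleCategory (D : Type u) [CellCategory.{c, p, v} D] where
  /-- external identity proarrow `id_x` -/
  hid : (x : D) → Pro x x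
  /-- external identity cell `id_f` -/
  hidCell : {x y : D} → (f : x ⟶ y) → Cell (hid x) (hid y)
  /-- external composition `m ⊙ n` of proarrows -/
  hcomp : {x y z : D} → Pro x y → Pro y z → Pro x z
  /-- external composition of cells -/
  hcell : {x y z x' y' z' : D} → {m : Pro x y} → {n : Pro y z} → {m' : Pro x' y'} →
    {n' : Pro y' z'} → (α : Cell m m') → (β : Cell n n') → tgt α = src β →
    Cell (hcomp m n) (hcomp m' n')
  src_hidCell : ∀ {x y : D} (f : x ⟶ y), src (hidCell f) = f
  tgt_hidCell : ∀ {x y : D} (f : x ⟶ y), tgt (hidCell f) = f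
  hidCell_id : ∀ x : D, hidCell (𝟙 x) = vid (hid x)
  hidCell_comp : ∀ {x y z : D} (f : x ⟶ y) (g : y ⟶ z),
    hidCell (f ≫ g) = hidCell f ⋆ hidCell g
  src_hcell : ∀ {x y z x' y' z' : D} {m : Pro x y} {n : Pro y z} {m' : Pro x' y'}
    {n' : Pro y' z'} (α : Cell m m') (β : Cell n n') (h : tgt α = src β),
    src (hcell α β h) = src α
  tgt_hcell : ∀ {x y z x' y' z' : D} {m : Pro x y} {n : Pro y z} {m' : Pro x' y'}
    {n' : Pro y' z'} (α : Cell m m') (β : Cell n n') (h : tgt α = src β),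
    tgt (hcell α β h) = tgt β
  hcell_vid : ∀ {x y z : D} (m : Pro x y) (n : Pro y z) (h : tgt (vid m) = src (vid n)),
    hcell (vid m) (vid n) h = vid (hcomp m n)
  /-- the interchange law -/
  hcell_vcomp : ∀ {x y z x' y' z' x'' y'' z'' : D} {m : Pro x y} {n : Pro y z}
    {m' : Pro x' y'} {n' : Pro y' z'} {m'' : Pro x'' y''} {n'' : Pro y'' z''}
    (α : Cell m m') (α' : Cell m' m'') (β : Cell n n') (β' : Cell n' n'')
    (h : tgt α = src β) (h' : tgt α' = src β') (h'' : tgt (α ⋆ α') = src (β ⋆ β')),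
    hcell (α ⋆ α') (β ⋆ β') h'' = hcell α β h ⋆ hcell α' β' h'
  /-- associators -/
  assoc' : {x y z w : D} → (m : Pro x y) → (n : Pro y z) → (k : Pro z w) →
    (hcomp (hcomp m n) k ≅ hcomp m (hcomp n k))
  /-- left unitors -/
  lunit : {x y : D} → (m : Pro x y) → (hcomp (hid x) m ≅ m)
  /-- right unitors -/
  runit : {x y : D} → (m : Pro x y) → (hcomp m (hid y) ≅ m)
  assoc_naturality : ∀ {x y z w x' y' z' w' : D} {m : Pro x y} {n : Pro y z} {k : Pro z w}
    {m' : Pro x' y'} {n' : Pro y' z'} {k' : Pro z' w'}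
    (α : Cell m m') (β : Cell n n') (γ : Cell k k') (h : tgt α = src β) (h' : tgt β = src γ)
    (h₁ : tgt (hcell α β h) = src γ) (h₂ : tgt α = src (hcell β γ h')),
    hcell (hcell α β h) γ h₁ ⋆ cellOf (assoc' m' n' k').hom =
      cellOf (assoc' m n k).hom ⋆ hcell α (hcell β γ h') h₂
  lunit_naturality : ∀ {x y x' y' : D} {m : Pro x y} {m' : Pro x' y'} (α : Cell m m')
    (h : tgt (hidCell (src α)) = src α),
    hcell (hidCell (src α)) α h ⋆ cellOf (lunit m').hom = cellOf (lunit m).hom ⋆ α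
  runit_naturality : ∀ {x y x' y' : D} {m : Pro x y} {m' : Pro x' y'} (α : Cell m m')
    (h : tgt α = src (hidCell (tgt α))),
    hcell α (hidCell (tgt α)) h ⋆ cellOf (runit m').hom = cellOf (runit m).hom ⋆ α
  pentagon' : ∀ {x y z w a : D} (m : Pro x y) (n : Pro y z) (k : Pro z w) (l : Pro w a)
    (h : tgt (cellOf (assoc' m n k).hom) = src (vid l))
    (h' : tgt (vid m) = src (cellOf (assoc' n k l).hom)),
    hcell (cellOf (assoc' m n k).hom) (vid l) h ⋆ cellOf (assoc' m (hcomp n k) l).hom ⋆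
        hcell (vid m) (cellOf (assoc' n k l).hom) h' =
      cellOf (assoc' (hcomp m n) k l).hom ⋆ cellOf (assoc' m n (hcomp k l)).hom
  triangle' : ∀ {x y z : D} (m : Pro x y) (n : Pro y z)
    (h : tgt (vid m) = src (cellOf (lunit n).hom))
    (h' : tgt (cellOf (runit m).hom) = src (vid n)),
    cellOf (assoc' m (hid y) n).hom ⋆ hcell (vid m) (cellOf (lunit n).hom) h =
      hcell (cellOf (runit m).hom) (vid n) h'

namespace DoubleCategory

attribute [simp] src_hidCell tgt_hidCell hidCell_id hidCell_comp src_hcell tgt_hcell hcell_vid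

/-- external composition of proarrows, in diagrammatic order -/
infixr:82 " ⊙ " => DoubleCategory.hcomp

variable {D : Type u} [CellCategory.{c, p, v} D] [DoubleCategory D]

/-- External composition of globular cells. -/
def hglob {x y z : D} {m m' : Pro x y} {n n' : Pro y z} (α : m ⟶ m') (β : n ⟶ n') :
    m ⊙ n ⟶ m' ⊙ n' :=
  Globular.mk (hcell (cellOf α) (cellOf β) (by simp)) (by simp) (by simp)

@[simp] theorem cellOf_hglob {x y z : D} {m m' : Pro x y} {n n' : Pro y z} (α : m ⟶ m')
    (β : n ⟶ n') : cellOf (hglob α β) = hcell (cellOf α) (cellOf β) (by simp) := rfl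

@[simp] theorem hglob_id {x y z : D} (m : Pro x y) (n : Pro y z) :
    hglob (𝟙 m) (𝟙 n) = 𝟙 (m ⊙ n) := by
  apply glob_ext; simp

theorem hglob_comp {x y z : D} {m m' m'' : Pro x y} {n n' n'' : Pro y z} (α : m ⟶ m')
    (α' : m' ⟶ m'') (β : n ⟶ n') (β' : n' ⟶ n'') :
    hglob (α ≫ α') (β ≫ β') = hglob α β ≫ hglob α' β' := by
  apply glob_ext
  simp only [cellOf_hglob, cellOf_comp]
  exact hcell_vcomp _ _ _ _ _ _ _

theorem hglob_assoc {x y z w : D} {m m' : Pro x y} {n n' : Pro y z} {k k' : Pro z w}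
    (α : m ⟶ m') (β : n ⟶ n') (γ : k ⟶ k') :
    hglob (hglob α β) γ ≫ (assoc' m' n' k').hom =
      (assoc' m n k).hom ≫ hglob α (hglob β γ) := by
  apply glob_ext
  simp only [cellOf_hglob, cellOf_comp]
  exact assoc_naturality _ _ _ _ _ _ _

theorem hcell_congr {x y z x' y' z' : D} {m : Pro x y} {n : Pro y z} {m' : Pro x' y'}
    {n' : Pro y' z'} {α α₁ : Cell m m'} {β β₁ : Cell n n'} (hα : α = α₁) (hβ : β = β₁)
    (h : tgt α = src β) (h₁ : tgt α₁ = src β₁) : hcell α β h = hcell α₁ β₁ h₁ := by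
  subst hα hβ; rfl

theorem lunit_hglob {x y : D} {m m' : Pro x y} (α : m ⟶ m') :
    hglob (𝟙 (hid x)) α ≫ (lunit m').hom = (lunit m).hom ≫ α := by
  apply glob_ext
  simp only [cellOf_hglob, cellOf_comp]
  rw [← lunit_naturality (cellOf α) (by simp)]
  congr 1
  exact hcell_congr (by simp) rfl _ _

theorem runit_hglob {x y : D} {m m' : Pro x y} (α : m ⟶ m') :
    hglob α (𝟙 (hid y)) ≫ (runit m').hom = (runit m).hom ≫ α := by
  apply glob_ext
  simp only [cellOf_hglob, cellOf_comp]
  rw [← runit_naturality (cellOf α) (by simp)]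
  congr 1
  exact hcell_congr rfl (by simp) _ _


theorem whiskerLeft_comp' {x y z : D} (m : Pro x y) {n n' n'' : Pro y z} (β : n ⟶ n')
    (β' : n' ⟶ n'') : hglob (𝟙 m) (β ≫ β') = hglob (𝟙 m) β ≫ hglob (𝟙 m) β' := by
  rw [← hglob_comp, Category.id_comp]

theorem comp_whiskerRight' {x y z : D} {m m' m'' : Pro x y} (α : m ⟶ m') (α' : m' ⟶ m'')
    (n : Pro y z) : hglob (α ≫ α') (𝟙 n) = hglob α (𝟙 n) ≫ hglob α' (𝟙 n) := by
  rw [← hglob_comp, Category.id_comp]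

theorem id_whiskerLeft' {x y : D} {m n : Pro x y} (β : m ⟶ n) :
    hglob (𝟙 (hid x)) β = (lunit m).hom ≫ β ≫ (lunit n).inv := by
  rw [← Category.assoc, Iso.eq_comp_inv, lunit_hglob]

theorem whiskerRight_id' {x y : D} {m n : Pro x y} (α : m ⟶ n) :
    hglob α (𝟙 (hid y)) = (runit m).hom ≫ α ≫ (runit n).inv := by
  rw [← Category.assoc, Iso.eq_comp_inv, runit_hglob]

theorem comp_whiskerLeft' {x y z w : D} (m : Pro x y) (n : Pro y z) {k k' : Pro z w}
    (β : k ⟶ k') : hglob (𝟙 (m ⊙ n)) β =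
      (assoc' m n k).hom ≫ hglob (𝟙 m) (hglob (𝟙 n) β) ≫ (assoc' m n k').inv := by
  rw [← Category.assoc, Iso.eq_comp_inv, ← hglob_assoc, hglob_id]

theorem whiskerRight_comp' {x y z w : D} {m m' : Pro x y} (α : m ⟶ m') (n : Pro y z)
    (k : Pro z w) : hglob α (𝟙 (n ⊙ k)) =
      (assoc' m n k).inv ≫ hglob (hglob α (𝟙 n)) (𝟙 k) ≫ (assoc' m' n k).hom := by
  rw [hglob_assoc, Iso.inv_hom_id_assoc, hglob_id]

theorem whisker_assoc' {x y z w : D} (m : Pro x y) {n n' : Pro y z} (β : n ⟶ n')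
    (k : Pro z w) : hglob (hglob (𝟙 m) β) (𝟙 k) =
      (assoc' m n k).hom ≫ hglob (𝟙 m) (hglob β (𝟙 k)) ≫ (assoc' m n' k).inv := by
  rw [← Category.assoc, Iso.eq_comp_inv, hglob_assoc]

theorem whisker_exchange' {x y z : D} {m n : Pro x y} {k l : Pro y z} (α : m ⟶ n)
    (β : k ⟶ l) : hglob (𝟙 m) β ≫ hglob α (𝟙 l) = hglob α (𝟙 k) ≫ hglob (𝟙 n) β := by
  rw [← hglob_comp, ← hglob_comp, Category.id_comp, Category.comp_id, Category.id_comp,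
    Category.comp_id]

/-- left whiskering of a globular cell -/
abbrev wl {x y z : D} (m : Pro x y) {n n' : Pro y z} (β : n ⟶ n') : m ⊙ n ⟶ m ⊙ n' :=
  hglob (𝟙 m) β

/-- right whiskering of a globular cell -/
abbrev wr {x y z : D} {m m' : Pro x y} (α : m ⟶ m') (n : Pro y z) : m ⊙ n ⟶ m' ⊙ n :=
  hglob α (𝟙 n)

theorem pentagon_glob {x y z w a : D} (m : Pro x y) (n : Pro y z) (k : Pro z w) (l : Pro w a) :
    wr (assoc' m n k).hom l ≫ (assoc' m (n ⊙ k) l).hom ≫ wl m (assoc' n k l).hom =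
      (assoc' (m ⊙ n) k l).hom ≫ (assoc' m n (k ⊙ l)).hom :=
  glob_ext (pentagon' m n k l (by simp) (by simp))

theorem triangle_glob {x y z : D} (m : Pro x y) (n : Pro y z) :
    (assoc' m (hid y) n).hom ≫ wl m (lunit n).hom = wr (runit m).hom n :=
  glob_ext (triangle' m n (by simp) (by simp))

end DoubleCategory

open DoubleCategory

/-! ## The underlying bicategory -/

/-- The underlying bicategory of a double category: same objects, with proarrows as 1-morphisms
and globular cells as 2-morphisms. -/
@[ext] structure UBicat (D : Type u) : Type u where
  /-- the object of the double category -/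
  as : D

namespace UBicat

variable {D : Type u} [CellCategory.{c, p, v} D] [DoubleCategory D]

instance : CategoryStruct.{p} (UBicat D) where
  Hom x y := Pro x.as y.as
  id x := hid x.as
  comp m n := m ⊙ n

instance : Bicategory.{c, p} (UBicat D) where
  homCategory x y := globularCategory x.as y.as
  whiskerLeft {x y z} m _ _ β := wl (x := x.as) (y := y.as) (z := z.as) m β
  whiskerRight {x y z} _ _ α n := wr (x := x.as) (y := y.as) (z := z.as) α n
  associator m n k := assoc' m n k
  leftUnitor m := lunit m
  rightUnitor m := runit m
  whiskerLeft_id m n := hglob_id m n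
  whiskerLeft_comp m _ _ _ β β' := whiskerLeft_comp' m β β'
  id_whiskerLeft β := id_whiskerLeft' β
  comp_whiskerLeft m n _ _ β := comp_whiskerLeft' m n β
  id_whiskerRight m n := hglob_id m n
  comp_whiskerRight α α' n := comp_whiskerRight' α α' n
  whiskerRight_id α := whiskerRight_id' α
  whiskerRight_comp α n k := whiskerRight_comp' α n k
  whisker_assoc m _ _ β k := whisker_assoc' m β k
  whisker_exchange α β := whisker_exchange' α β
  pentagon m n k l := pentagon_glob m n k l
  triangle m n := triangle_glob m n

end UBicat

/-! ## Double functors -/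

/-- A (pseudo) double functor: a functor on objects and arrows, a functorial action on proarrows
and cells, and coherent natural globular isomorphisms comparing external composites and
identities. -/
structure DoubleFunctor (D : Type u₁) [CellCategory.{c₁, p₁, v₁} D] [DoubleCategory D]
    (E : Type u₂) [CellCategory.{c₂, p₂, v₂} E] [DoubleCategory E] extends D ⥤ E where
  /-- action on proarrows -/
  mapPro : {x y : D} → Pro x y → Pro (obj x) (obj y)
  /-- action on cells -/
  mapCell : {x y w z : D} → {m : Pro x y} → {n : Pro w z} → Cell m n →
    Cell (mapPro m) (mapPro n)
  src_mapCell : ∀ {x y w z : D} {m : Pro x y} {n : Pro w z} (α : Cell m n),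
    src (mapCell α) = map (src α)
  tgt_mapCell : ∀ {x y w z : D} {m : Pro x y} {n : Pro w z} (α : Cell m n),
    tgt (mapCell α) = map (tgt α)
  mapCell_vid : ∀ {x y : D} (m : Pro x y), mapCell (vid m) = vid (mapPro m)
  mapCell_vcomp : ∀ {x y w z a b : D} {m : Pro x y} {n : Pro w z} {k : Pro a b}
    (α : Cell m n) (β : Cell n k), mapCell (α ⋆ β) = mapCell α ⋆ mapCell β
  /-- comparison isomorphisms for external composition -/
  mapComp : {x y z : D} → (m : Pro x y) → (n : Pro y z) →
    (mapPro m ⊙ mapPro n ≅ mapPro (m ⊙ n))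
  /-- comparison isomorphisms for external identities -/
  mapId : (x : D) → (hid (obj x) ≅ mapPro (hid x))
  mapComp_naturality : ∀ {x y z x' y' z' : D} {m : Pro x y} {n : Pro y z} {m' : Pro x' y'}
    {n' : Pro y' z'} (α : Cell m m') (β : Cell n n') (h : tgt α = src β)
    (h' : tgt (mapCell α) = src (mapCell β)),
    hcell (mapCell α) (mapCell β) h' ⋆ cellOf (mapComp m' n').hom =
      cellOf (mapComp m n).hom ⋆ mapCell (hcell α β h)
  mapId_naturality : ∀ {x y : D} (f : x ⟶ y),
    hidCell (map f) ⋆ cellOf (mapId y).hom = cellOf (mapId x).hom ⋆ mapCell (hidCell f)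
  map_assoc : ∀ {x y z w : D} (m : Pro x y) (n : Pro y z) (k : Pro z w)
    (h : tgt (cellOf (mapComp m n).hom) = src (vid (mapPro k)))
    (h' : tgt (vid (mapPro m)) = src (cellOf (mapComp n k).hom)),
    hcell (cellOf (mapComp m n).hom) (vid (mapPro k)) h ⋆ cellOf (mapComp (m ⊙ n) k).hom ⋆
        mapCell (cellOf (assoc' m n k).hom) =
      cellOf (assoc' (mapPro m) (mapPro n) (mapPro k)).hom ⋆
        hcell (vid (mapPro m)) (cellOf (mapComp n k).hom) h' ⋆ cellOf (mapComp m (n ⊙ k)).hom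
  map_lunit : ∀ {x y : D} (m : Pro x y)
    (h : tgt (cellOf (mapId x).hom) = src (vid (mapPro m))),
    hcell (cellOf (mapId x).hom) (vid (mapPro m)) h ⋆ cellOf (mapComp (hid x) m).hom ⋆
        mapCell (cellOf (lunit m).hom) =
      cellOf (lunit (mapPro m)).hom
  map_runit : ∀ {x y : D} (m : Pro x y)
    (h : tgt (vid (mapPro m)) = src (cellOf (mapId y).hom)),
    hcell (vid (mapPro m)) (cellOf (mapId y).hom) h ⋆ cellOf (mapComp m (hid y)).hom ⋆
        mapCell (cellOf (runit m).hom) =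
      cellOf (runit (mapPro m)).hom

namespace DoubleFunctor

attribute [simp] src_mapCell tgt_mapCell mapCell_vid mapCell_vcomp

section

variable {D : Type u₁} [CellCategory.{c₁, p₁, v₁} D] [DoubleCategory D]
  {E : Type u₂} [CellCategory.{c₂, p₂, v₂} E] [DoubleCategory E] (F : DoubleFunctor D E)

/-- The action of a double functor on globular cells. -/
def mapGlob {x y : D} {m n : Pro x y} (α : m ⟶ n) : F.mapPro m ⟶ F.mapPro n :=
  Globular.mk (F.mapCell (cellOf α)) (by simp) (by simp)

@[simp] theorem cellOf_mapGlob {x y : D} {m n : Pro x y} (α : m ⟶ n) :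
    cellOf (F.mapGlob α) = F.mapCell (cellOf α) := rfl

@[simp] theorem mapGlob_id {x y : D} (m : Pro x y) : F.mapGlob (𝟙 m) = 𝟙 (F.mapPro m) :=
  glob_ext (F.mapCell_vid m)

@[simp] theorem mapGlob_comp {x y : D} {m n k : Pro x y} (α : m ⟶ n) (β : n ⟶ k) :
    F.mapGlob (α ≫ β) = F.mapGlob α ≫ F.mapGlob β :=
  glob_ext (F.mapCell_vcomp (cellOf α) (cellOf β))

/-- The action of a double functor on invertible globular cells. -/
@[simps] def mapGlobIso {x y : D} {m n : Pro x y} (e : m ≅ n) : F.mapPro m ≅ F.mapPro n where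
  hom := F.mapGlob e.hom
  inv := F.mapGlob e.inv
  hom_inv_id := by rw [← mapGlob_comp, e.hom_inv_id, mapGlob_id]
  inv_hom_id := by rw [← mapGlob_comp, e.inv_hom_id, mapGlob_id]

theorem glob_hglob {x y z : D} {m m' : Pro x y} {n n' : Pro y z} (α : m ⟶ m') (β : n ⟶ n') :
    hglob (F.mapGlob α) (F.mapGlob β) ≫ (F.mapComp m' n').hom =
      (F.mapComp m n).hom ≫ F.mapGlob (hglob α β) :=
  glob_ext (F.mapComp_naturality (cellOf α) (cellOf β) (by simp) (by simp))

theorem glob_assoc {x y z w : D} (m : Pro x y) (n : Pro y z) (k : Pro z w) :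
    wr (F.mapComp m n).hom (F.mapPro k) ≫ (F.mapComp (m ⊙ n) k).hom ≫
        F.mapGlob (assoc' m n k).hom =
      (assoc' (F.mapPro m) (F.mapPro n) (F.mapPro k)).hom ≫
        wl (F.mapPro m) (F.mapComp n k).hom ≫ (F.mapComp m (n ⊙ k)).hom :=
  glob_ext (F.map_assoc m n k (by simp) (by simp))

theorem glob_lunit {x y : D} (m : Pro x y) :
    wr (F.mapId x).hom (F.mapPro m) ≫ (F.mapComp (hid x) m).hom ≫
      F.mapGlob (lunit m).hom = (lunit (F.mapPro m)).hom :=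
  glob_ext (F.map_lunit m (by simp))

theorem glob_runit {x y : D} (m : Pro x y) :
    wl (F.mapPro m) (F.mapId y).hom ≫ (F.mapComp m (hid y)).hom ≫
      F.mapGlob (runit m).hom = (runit (F.mapPro m)).hom :=
  glob_ext (F.map_runit m (by simp))

theorem wr_inv_hom {x y z : D} {m m' : Pro x y} (e : m ≅ m') (n : Pro y z) :
    wr e.inv n ≫ wr e.hom n = 𝟙 _ := by
  rw [← comp_whiskerRight', e.inv_hom_id, hglob_id]

theorem wl_hom_inv {x y z : D} (m : Pro x y) {n n' : Pro y z} (e : n ≅ n') :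
    wl m e.hom ≫ wl m e.inv = 𝟙 _ := by
  rw [← whiskerLeft_comp', e.hom_inv_id, hglob_id]

theorem wl_inv_hom {x y z : D} (m : Pro x y) {n n' : Pro y z} (e : n ≅ n') :
    wl m e.inv ≫ wl m e.hom = 𝟙 _ := by
  rw [← whiskerLeft_comp', e.inv_hom_id, hglob_id]

theorem glob_whiskerLeft {x y z : D} (m : Pro x y) {n n' : Pro y z} (β : n ⟶ n') :
    F.mapGlob (wl m β) =
      (F.mapComp m n).inv ≫ wl (F.mapPro m) (F.mapGlob β) ≫ (F.mapComp m n').hom := by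
  rw [Iso.eq_inv_comp, ← F.glob_hglob, F.mapGlob_id]

theorem glob_whiskerRight {x y z : D} {m m' : Pro x y} (α : m ⟶ m') (n : Pro y z) :
    F.mapGlob (wr α n) =
      (F.mapComp m n).inv ≫ wr (F.mapGlob α) (F.mapPro n) ≫ (F.mapComp m' n).hom := by
  rw [Iso.eq_inv_comp, ← F.glob_hglob, F.mapGlob_id]

theorem glob_assoc_eq {x y z w : D} (m : Pro x y) (n : Pro y z) (k : Pro z w) :
    F.mapGlob (assoc' m n k).hom =
      (F.mapComp (m ⊙ n) k).inv ≫ wr (F.mapComp m n).inv (F.mapPro k) ≫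
        (assoc' (F.mapPro m) (F.mapPro n) (F.mapPro k)).hom ≫
          wl (F.mapPro m) (F.mapComp n k).hom ≫ (F.mapComp m (n ⊙ k)).hom := by
  rw [← F.glob_assoc, ← Category.assoc (wr _ _), wr_inv_hom, Category.id_comp,
    Iso.inv_hom_id_assoc]

theorem glob_lunit_eq {x y : D} (m : Pro x y) :
    F.mapGlob (lunit m).hom =
      (F.mapComp (hid x) m).inv ≫ wr (F.mapId x).inv (F.mapPro m) ≫
        (lunit (F.mapPro m)).hom := by
  rw [← F.glob_lunit, ← Category.assoc (wr _ _), wr_inv_hom, Category.id_comp,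
    Iso.inv_hom_id_assoc]

theorem glob_runit_eq {x y : D} (m : Pro x y) :
    F.mapGlob (runit m).hom =
      (F.mapComp m (hid y)).inv ≫ wl (F.mapPro m) (F.mapId y).inv ≫
        (runit (F.mapPro m)).hom := by
  rw [← F.glob_runit, ← Category.assoc (wl _ _), wl_inv_hom, Category.id_comp,
    Iso.inv_hom_id_assoc]

/-- The pseudofunctor between underlying bicategories that has the same action on objects,
proarrows and globular cells and the same comparison isomorphisms. -/
def toPseudofunctor : UBicat D ⥤ᵖ UBicat E where
  obj x := ⟨F.obj x.as⟩
  map m := F.mapPro m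
  map₂ α := F.mapGlob α
  map₂_id m := F.mapGlob_id m
  map₂_comp α β := F.mapGlob_comp α β
  mapId x := (F.mapId x.as).symm
  mapComp m n := (F.mapComp m n).symm
  map₂_whisker_left m _ _ β := F.glob_whiskerLeft m β
  map₂_whisker_right α n := F.glob_whiskerRight α n
  map₂_associator m n k := F.glob_assoc_eq m n k
  map₂_left_unitor m := F.glob_lunit_eq m
  map₂_right_unitor m := F.glob_runit_eq m

theorem mapComp_wr {x y z : D} {m m' : Pro x y} (α : m ⟶ m') (n : Pro y z) :
    wr (F.mapGlob α) (F.mapPro n) ≫ (F.mapComp m' n).hom =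
      (F.mapComp m n).hom ≫ F.mapGlob (wr α n) := by
  rw [← F.glob_hglob, F.mapGlob_id]

theorem mapComp_wl {x y z : D} (m : Pro x y) {n n' : Pro y z} (β : n ⟶ n') :
    wl (F.mapPro m) (F.mapGlob β) ≫ (F.mapComp m n').hom =
      (F.mapComp m n).hom ≫ F.mapGlob (wl m β) := by
  rw [← F.glob_hglob, F.mapGlob_id]

end

section

variable {D : Type u₁} [CellCategory.{c₁, p₁, v₁} D] [DoubleCategory D]
    {E : Type u₂} [CellCategory.{c₂, p₂, v₂} E] [DoubleCategory E]
    {C : Type u₃} [CellCategory.{c₃, p₃, v₃} C] [DoubleCategory C]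
    (F : DoubleFunctor D E) (G : DoubleFunctor E C)

theorem comp_assoc_aux {x y z w : D} (m : Pro x y) (n : Pro y z) (k : Pro z w) :
    wr ((G.mapComp (F.mapPro m) (F.mapPro n)).hom ≫ G.mapGlob (F.mapComp m n).hom)
        (G.mapPro (F.mapPro k)) ≫
      ((G.mapComp (F.mapPro (m ⊙ n)) (F.mapPro k)).hom ≫
        G.mapGlob (F.mapComp (m ⊙ n) k).hom) ≫ G.mapGlob (F.mapGlob (assoc' m n k).hom) =
    (assoc' (G.mapPro (F.mapPro m)) (G.mapPro (F.mapPro n)) (G.mapPro (F.mapPro k))).hom ≫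
      wl (G.mapPro (F.mapPro m))
        ((G.mapComp (F.mapPro n) (F.mapPro k)).hom ≫ G.mapGlob (F.mapComp n k).hom) ≫
      (G.mapComp (F.mapPro m) (F.mapPro (n ⊙ k))).hom ≫
        G.mapGlob (F.mapComp m (n ⊙ k)).hom := by
  have h₁ := G.mapComp_wr (F.mapComp m n).hom (F.mapPro k)
  have h₂ := F.glob_assoc m n k
  have h₃ := G.glob_assoc (F.mapPro m) (F.mapPro n) (F.mapPro k)
  have h₄ := G.mapComp_wl (F.mapPro m) (F.mapComp n k).hom
  have h₅ := congrArg G.mapGlob h₂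
  simp only [mapGlob_comp] at h₅
  simp only [wr, wl] at *
  rw [comp_whiskerRight', whiskerLeft_comp']
  simp only [Category.assoc]
  rw [reassoc_of% h₁, h₅, reassoc_of% h₃, reassoc_of% h₄]

theorem comp_lunit_aux {x y : D} (m : Pro x y) :
    wr ((G.mapId (F.obj x)).hom ≫ G.mapGlob (F.mapId x).hom) (G.mapPro (F.mapPro m)) ≫
      ((G.mapComp (F.mapPro (hid x)) (F.mapPro m)).hom ≫
        G.mapGlob (F.mapComp (hid x) m).hom) ≫ G.mapGlob (F.mapGlob (lunit m).hom) =
    (lunit (G.mapPro (F.mapPro m))).hom := by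
  have h₁ := G.mapComp_wr (F.mapId x).hom (F.mapPro m)
  have h₂ := congrArg G.mapGlob (F.glob_lunit m)
  have h₃ := G.glob_lunit (F.mapPro m)
  simp only [mapGlob_comp] at h₂
  simp only [wr] at *
  rw [comp_whiskerRight']
  simp only [Category.assoc]
  rw [reassoc_of% h₁, h₂, h₃]

theorem comp_runit_aux {x y : D} (m : Pro x y) :
    wl (G.mapPro (F.mapPro m)) ((G.mapId (F.obj y)).hom ≫ G.mapGlob (F.mapId y).hom) ≫
      ((G.mapComp (F.mapPro m) (F.mapPro (hid y))).hom ≫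
        G.mapGlob (F.mapComp m (hid y)).hom) ≫ G.mapGlob (F.mapGlob (runit m).hom) =
    (runit (G.mapPro (F.mapPro m))).hom := by
  have h₁ := G.mapComp_wl (F.mapPro m) (F.mapId y).hom
  have h₂ := congrArg G.mapGlob (F.glob_runit m)
  have h₃ := G.glob_runit (F.mapPro m)
  simp only [mapGlob_comp] at h₂
  simp only [wl] at *
  rw [whiskerLeft_comp']
  simp only [Category.assoc]
  rw [reassoc_of% h₁, h₂, h₃]

end

/-- The identity double functor. -/
def id (D : Type u₁) [CellCategory.{c₁, p₁, v₁} D] [DoubleCategory D] : DoubleFunctor D D where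
  toFunctor := 𝟭 D
  mapPro m := m
  mapCell α := α
  src_mapCell _ := rfl
  tgt_mapCell _ := rfl
  mapCell_vid _ := rfl
  mapCell_vcomp _ _ := rfl
  mapComp m n := Iso.refl (m ⊙ n)
  mapId x := Iso.refl (hid x)
  mapComp_naturality _ _ _ _ := by simp
  mapId_naturality _ := by simp
  map_assoc _ _ _ _ _ := by simp
  map_lunit _ _ := by simp
  map_runit _ _ := by simp

/-- The composite of two double functors, in diagrammatic order. -/
def comp {D : Type u₁} [CellCategory.{c₁, p₁, v₁} D] [DoubleCategory D]
    {E : Type u₂} [CellCategory.{c₂, p₂, v₂} E] [DoubleCategory E]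
    {C : Type u₃} [CellCategory.{c₃, p₃, v₃} C] [DoubleCategory C]
    (F : DoubleFunctor D E) (G : DoubleFunctor E C) : DoubleFunctor D C where
  toFunctor := F.toFunctor ⋙ G.toFunctor
  mapPro m := G.mapPro (F.mapPro m)
  mapCell α := G.mapCell (F.mapCell α)
  src_mapCell _ := by simp
  tgt_mapCell _ := by simp
  mapCell_vid _ := by simp
  mapCell_vcomp _ _ := by simp
  mapComp m n := G.mapComp (F.mapPro m) (F.mapPro n) ≪≫
    G.mapGlobIso (F.mapComp m n)
  mapId x := G.mapId (F.obj x) ≪≫ G.mapGlobIso (F.mapId x)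
  mapComp_naturality α β h h' := by
    have hF : tgt (F.mapCell α) = src (F.mapCell β) := by simp [h]
    have h₁ := G.mapComp_naturality (F.mapCell α) (F.mapCell β) hF h'
    have h₂ := congrArg G.mapCell (F.mapComp_naturality α β h hF)
    simp only [mapCell_vcomp] at h₂
    simp only [Iso.trans_hom, mapGlobIso_hom, cellOf_comp, cellOf_mapGlob, vcomp_assoc]
    rw [← vcomp_assoc, h₁, vcomp_assoc, h₂]
  mapId_naturality f := by
    have h₁ := G.mapId_naturality (F.map f)
    have h₂ := congrArg G.mapCell (F.mapId_naturality f)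
    simp only [mapCell_vcomp] at h₂
    simp only [Iso.trans_hom, mapGlobIso_hom, cellOf_comp, cellOf_mapGlob, vcomp_assoc,
      Functor.comp_map]
    rw [← vcomp_assoc, h₁, vcomp_assoc, h₂]
  map_assoc m n k _ _ := congrArg cellOf (comp_assoc_aux F G m n k)
  map_lunit m _ := congrArg cellOf (comp_lunit_aux F G m)
  map_runit m _ := congrArg cellOf (comp_runit_aux F G m)

end DoubleFunctor

/-! ## Natural transformations and double adjunctions -/

/-- A natural transformation between double functors: arrows `α_x` and cells `α_m` with source
`α_x` and target `α_y`, natural in arrows and cells and compatible with external composition and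
identities. -/
structure DoubleNatTrans {D : Type u₁} [CellCategory.{c₁, p₁, v₁} D] [DoubleCategory D]
    {E : Type u₂} [CellCategory.{c₂, p₂, v₂} E] [DoubleCategory E]
    (F G : DoubleFunctor D E) extends NatTrans F.toFunctor G.toFunctor where
  /-- component cell at a proarrow -/
  appPro : {x y : D} → (m : Pro x y) → Cell (F.mapPro m) (G.mapPro m)
  src_appPro : ∀ {x y : D} (m : Pro x y), src (appPro m) = app x
  tgt_appPro : ∀ {x y : D} (m : Pro x y), tgt (appPro m) = app y
  cell_naturality : ∀ {x y w z : D} {m : Pro x y} {n : Pro w z} (α : Cell m n),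
    F.mapCell α ⋆ appPro n = appPro m ⋆ G.mapCell α
  appPro_hcomp : ∀ {x y z : D} (m : Pro x y) (n : Pro y z)
    (h : tgt (appPro m) = src (appPro n)),
    cellOf (F.mapComp m n).hom ⋆ appPro (m ⊙ n) =
      hcell (appPro m) (appPro n) h ⋆ cellOf (G.mapComp m n).hom
  appPro_hid : ∀ x : D,
    cellOf (F.mapId x).hom ⋆ appPro (hid x) = hidCell (app x) ⋆ cellOf (G.mapId x).hom

/-- A (pseudo) double adjunction `(η, ε) : F ⊣ G`, i.e. an adjunction in the 2-category of double
categories, double functors and natural transformations: natural transformations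
`η : 1 ⟶ G ∘ F` and `ε : F ∘ G ⟶ 1` satisfying the triangle identities strictly, on objects and
on proarrows. -/
structure DoubleAdjunction {D : Type u₁} [CellCategory.{c₁, p₁, v₁} D] [DoubleCategory D]
    {E : Type u₂} [CellCategory.{c₂, p₂, v₂} E] [DoubleCategory E]
    (F : DoubleFunctor D E) (G : DoubleFunctor E D) where
  /-- the unit -/
  unit : DoubleNatTrans (DoubleFunctor.id D) (F.comp G)
  /-- the counit -/
  counit : DoubleNatTrans (G.comp F) (DoubleFunctor.id E)
  left_triangle : ∀ x : D, F.map (unit.app x) ≫ counit.app (F.obj x) = 𝟙 (F.obj x)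
  left_triangle_pro : ∀ {x y : D} (m : Pro x y),
    F.mapCell (unit.appPro m) ⋆ counit.appPro (F.mapPro m) = vid (F.mapPro m)
  right_triangle : ∀ y : E, unit.app (G.obj y) ≫ G.map (counit.app y) = 𝟙 (G.obj y)
  right_triangle_pro : ∀ {x y : E} (n : Pro x y),
    unit.appPro (G.mapPro n) ⋆ G.mapCell (counit.appPro n) = vid (G.mapPro n)

/-! ## Companions -/

section Companions

variable {D : Type u} [CellCategory.{c, p, v} D] [DoubleCategory D]

/-- A companion of an arrow `f : x ⟶ y`: a proarrow `f_! : x ⇸ y` with binding cells `unit` and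
`counit` such that `unit ⊙ counit = 1` (up to the unit isomorphisms) and
`unit ⋆ counit = id_f`. -/
structure Companion {x y : D} (f : x ⟶ y) where
  /-- the companion proarrow -/
  pro : Pro x y
  /-- the unit cell -/
  unit : Cell (hid x) pro
  /-- the counit cell -/
  counit : Cell pro (hid y)
  src_unit : src unit = 𝟙 x
  tgt_unit : tgt unit = f
  src_counit : src counit = f
  tgt_counit : tgt counit = 𝟙 y
  unit_hcell_counit : ∀ h : tgt unit = src counit,
    hcell unit counit h ⋆ cellOf (runit pro).hom = cellOf (lunit pro).hom
  unit_vcomp_counit : unit ⋆ counit = hidCell f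

/-- Sliding: given companions of `f : x ⟶ w` and `g : y ⟶ z`, a cell `α` from `m : x ⇸ y` to
`n : w ⇸ z` with source `f` and target `g` is reshaped into the globular cell
`α_! : m ⊙ g_! ⟶ f_! ⊙ n` obtained by pasting `α` with the unit of `f_!` on the left and with the
counit of `g_!` on the right. -/
def slide {x y w z : D} {f : x ⟶ w} {g : y ⟶ z} (cf : Companion f) (cg : Companion g)
    {m : Pro x y} {n : Pro w z} (α : Cell m n) (hs : src α = f) (ht : tgt α = g) :
    m ⊙ cg.pro ⟶ cf.pro ⊙ n :=
  wr (lunit m).inv cg.pro ≫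
    Globular.mk
      (hcell (hcell cf.unit α (cf.tgt_unit.trans hs.symm)) cg.counit
        ((tgt_hcell _ _ _).trans (ht.trans cg.src_counit.symm)))
      (by simp [cf.src_unit]) (by simp [cg.tgt_counit]) ≫
    (runit (cf.pro ⊙ n)).hom

/-- A cell whose source and target arrows have (chosen) companions is a commuter if the globular
cell obtained from it by sliding is invertible. -/
def IsCommuter {x y w z : D} {f : x ⟶ w} {g : y ⟶ z} (cf : Companion f) (cg : Companion g)
    {m : Pro x y} {n : Pro w z} (α : Cell m n) (hs : src α = f) (ht : tgt α = g) : Prop :=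
  IsIso (slide cf cg α hs ht)

end Companions

section Transpose

variable {D : Type u₁} [CellCategory.{c₁, p₁, v₁} D] [DoubleCategory D]
  {E : Type u₂} [CellCategory.{c₂, p₂, v₂} E] [DoubleCategory E] {F G : DoubleFunctor D E}

/-- All the component cells of a natural transformation, whose component arrows have companions,
are commuters. -/
def DoubleNatTrans.HasCommuterCells (α : DoubleNatTrans F G)
    (comp : ∀ x, Companion (α.app x)) : Prop :=
  ∀ {x y : D} (m : Pro x y),
    IsCommuter (comp x) (comp y) (α.appPro m) (α.src_appPro m) (α.tgt_appPro m)

/-- The data `(app, nat)` of an oplax natural transformation between the underlying pseudofunctors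
is the transpose `α_!` of the natural transformation `α` with respect to chosen companions of the
component arrows: the component at `x` is the companion `(α_x)_!`, and the naturality comparison at
a proarrow `m` is obtained from the component cell `α_m` by sliding. -/
def DoubleNatTrans.IsTranspose (α : DoubleNatTrans F G) (comp : ∀ x, Companion (α.app x))
    (app : ∀ x : D, Pro (F.obj x) (G.obj x))
    (nat : ∀ {x y : D} (m : Pro x y), F.mapPro m ⊙ app y ⟶ app x ⊙ G.mapPro m) : Prop :=
  ∃ h : ∀ x, app x = (comp x).pro, ∀ {x y : D} (m : Pro x y),
    nat m ≫ wr (eqToHom (h x)) (G.mapPro m) =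
      wl (F.mapPro m) (eqToHom (h y)) ≫
        slide (comp x) (comp y) (α.appPro m) (α.src_appPro m) (α.tgt_appPro m)

end Transpose

/-! ## Lax adjunctions between bicategories -/

namespace LaxAdj

section Aux

variable {B : Type u₁} [Bicategory.{c₁, v₁} B] {C : Type u₂} [Bicategory.{c₂, v₂} C]

theorem pre_id {a b : B} {f : a ⟶ a} {f' : b ⟶ b} {f₁ : a ⟶ a} {f₁' : b ⟶ b} {p : a ⟶ b}
    {n : f ≫ p ⟶ p ≫ f'} {n₁ : f₁ ≫ p ⟶ p ≫ f₁'} {I : f ⟶ f₁} {I' : f' ⟶ f₁'}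
    {i : f₁ ⟶ 𝟙 a} {i' : f₁' ⟶ 𝟙 b} (h₁ : I ▷ p ≫ n₁ = n ≫ p ◁ I')
    (h₂ : n₁ ≫ p ◁ i' = i ▷ p ≫ (λ_ p).hom ≫ (ρ_ p).inv) {j : f ⟶ 𝟙 a} {j' : f' ⟶ 𝟙 b}
    (hj : j = I ≫ i) (hj' : j' = I' ≫ i') :
    n ≫ p ◁ j' = j ▷ p ≫ (λ_ p).hom ≫ (ρ_ p).inv := by
  subst hj hj'
  rw [whiskerLeft_comp, ← reassoc_of% h₁, h₂, comp_whiskerRight, Category.assoc]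

theorem pre_comp {a b c a' b' c' : B} {k k₁ : a ⟶ c} {k' k₁' : a' ⟶ c'} {f : a ⟶ b} {g : b ⟶ c}
    {f' : a' ⟶ b'} {g' : b' ⟶ c'} {p : a ⟶ a'} {q : b ⟶ b'} {r : c ⟶ c'}
    {nk : k ≫ r ⟶ p ≫ k'} {nk₁ : k₁ ≫ r ⟶ p ≫ k₁'} {nf : f ≫ q ⟶ p ≫ f'}
    {ng : g ≫ r ⟶ q ≫ g'} {I : k ⟶ k₁} {I' : k' ⟶ k₁'} {i : k₁ ⟶ f ≫ g} {i' : k₁' ⟶ f' ≫ g'}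
    (h₁ : I ▷ r ≫ nk₁ = nk ≫ p ◁ I')
    (h₂ : nk₁ ≫ p ◁ i' = i ▷ r ≫ (α_ _ _ _).hom ≫ f ◁ ng ≫ (α_ _ _ _).inv ≫ nf ▷ g' ≫
      (α_ _ _ _).hom) {j : k ⟶ f ≫ g} {j' : k' ⟶ f' ≫ g'} (hj : j = I ≫ i) (hj' : j' = I' ≫ i') :
    nk ≫ p ◁ j' = j ▷ r ≫ (α_ _ _ _).hom ≫ f ◁ ng ≫ (α_ _ _ _).inv ≫ nf ▷ g' ≫
      (α_ _ _ _).hom := by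
  subst hj hj'
  rw [whiskerLeft_comp, ← reassoc_of% h₁, h₂, comp_whiskerRight, Category.assoc]

variable (H : B ⥤ᵖ C)

/-- The image under a pseudofunctor of a 2-morphism between composites. -/
abbrev mapSq {a b a' b' : B} {f : a ⟶ b} {q : b ⟶ b'} {p : a ⟶ a'} {f' : a' ⟶ b'}
    (n : f ≫ q ⟶ p ≫ f') : H.map f ≫ H.map q ⟶ H.map p ≫ H.map f' :=
  (H.mapComp f q).inv ≫ H.map₂ n ≫ (H.mapComp p f').hom

theorem post_naturality {a b a' b' : B} {f g : a ⟶ b} {f' g' : a' ⟶ b'} {p : a ⟶ a'}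
    {q : b ⟶ b'} {β : f ⟶ g} {β' : f' ⟶ g'} {nf : f ≫ q ⟶ p ≫ f'} {ng : g ≫ q ⟶ p ≫ g'}
    (h : β ▷ q ≫ ng = nf ≫ p ◁ β') :
    H.map₂ β ▷ H.map q ≫ mapSq H ng = mapSq H nf ≫ H.map p ◁ H.map₂ β' := by
  have h' := congrArg H.map₂ h
  simp only [PrelaxFunctor.map₂_comp, Pseudofunctor.map₂_whisker_right,
    Pseudofunctor.map₂_whisker_left, Category.assoc] at h'
  rw [← cancel_epi (H.mapComp f q).hom, ← cancel_mono (H.mapComp p g').inv]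
  simpa [mapSq] using h'

theorem post_id {a b : B} {f : a ⟶ a} {f' : b ⟶ b} {p : a ⟶ b}
    {n : f ≫ p ⟶ p ≫ f'} {i : f ⟶ 𝟙 a} {i' : f' ⟶ 𝟙 b}
    (h : n ≫ p ◁ i' = i ▷ p ≫ (λ_ p).hom ≫ (ρ_ p).inv)
    {j : H.map f ⟶ 𝟙 (H.obj a)} {j' : H.map f' ⟶ 𝟙 (H.obj b)}
    (hj : j = H.map₂ i ≫ (H.mapId a).hom) (hj' : j' = H.map₂ i' ≫ (H.mapId b).hom) :
    mapSq H n ≫ H.map p ◁ j' = j ▷ H.map p ≫ (λ_ (H.map p)).hom ≫ (ρ_ (H.map p)).inv := by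
  subst hj hj'
  have h' := congrArg H.map₂ h
  simp only [PrelaxFunctor.map₂_comp, Pseudofunctor.map₂_whisker_right,
    Pseudofunctor.map₂_whisker_left, Category.assoc] at h'
  have hr : H.map₂ (ρ_ p).inv ≫ (H.mapComp p (𝟙 b)).hom ≫ H.map p ◁ (H.mapId b).hom =
      (ρ_ (H.map p)).inv := by
    rw [← cancel_epi (H.map₂ (ρ_ p).hom), ← PrelaxFunctor.map₂_comp_assoc, Iso.hom_inv_id,
      PrelaxFunctor.map₂_id, Category.id_comp, Pseudofunctor.map₂_right_unitor]
    simp only [Category.assoc, Iso.hom_inv_id, Category.comp_id]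
  have hl : (H.mapComp (𝟙 a) p).inv ≫ H.map₂ (λ_ p).hom =
      (H.mapId a).hom ▷ H.map p ≫ (λ_ (H.map p)).hom := by
    rw [Pseudofunctor.map₂_left_unitor, Iso.inv_hom_id_assoc]
  rw [← Category.assoc, ← Category.assoc, Iso.comp_inv_eq] at h'
  simp only [Category.assoc] at h'
  simp only [mapSq, whiskerLeft_comp, comp_whiskerRight, Category.assoc]
  rw [reassoc_of% h', hr, reassoc_of% hl, Iso.inv_hom_id_assoc]

theorem map_assoc_hom {a b c d : B} (f : a ⟶ b) (g : b ⟶ c) (h : c ⟶ d) :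
    (H.mapComp (f ≫ g) h).inv ≫ H.map₂ (α_ f g h).hom ≫ (H.mapComp f (g ≫ h)).hom =
      (H.mapComp f g).hom ▷ H.map h ≫ (α_ _ _ _).hom ≫ H.map f ◁ (H.mapComp g h).inv := by
  rw [Pseudofunctor.map₂_associator]
  simp only [Category.assoc, Iso.inv_hom_id, Iso.inv_hom_id_assoc, Category.comp_id]

theorem map_assoc_inv {a b c d : B} (f : a ⟶ b) (g : b ⟶ c) (h : c ⟶ d) :
    (H.mapComp f (g ≫ h)).inv ≫ H.map₂ (α_ f g h).inv ≫ (H.mapComp (f ≫ g) h).hom =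
      H.map f ◁ (H.mapComp g h).hom ≫ (α_ _ _ _).inv ≫ (H.mapComp f g).inv ▷ H.map h := by
  have e : (H.mapComp (f ≫ g) h).symm ≪≫ H.map₂Iso (α_ f g h) ≪≫ H.mapComp f (g ≫ h) =
      whiskerRightIso (H.mapComp f g) (H.map h) ≪≫ α_ _ _ _ ≪≫
        whiskerLeftIso (H.map f) (H.mapComp g h).symm := Iso.ext (map_assoc_hom H f g h)
  have e' := congrArg Iso.inv e
  simpa only [Iso.trans_inv, Iso.symm_inv, PrelaxFunctor.map₂Iso_inv, whiskerRightIso_inv,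
    whiskerLeftIso_inv, Category.assoc] using e'

theorem post_comp {a b c a' b' c' : B} {k : a ⟶ c} {k' : a' ⟶ c'} {f : a ⟶ b} {g : b ⟶ c}
    {f' : a' ⟶ b'} {g' : b' ⟶ c'} {p : a ⟶ a'} {q : b ⟶ b'} {r : c ⟶ c'}
    {nk : k ≫ r ⟶ p ≫ k'} {nf : f ≫ q ⟶ p ≫ f'}
    {ng : g ≫ r ⟶ q ≫ g'} {i : k ⟶ f ≫ g} {i' : k' ⟶ f' ≫ g'}
    (h : nk ≫ p ◁ i' = i ▷ r ≫ (α_ _ _ _).hom ≫ f ◁ ng ≫ (α_ _ _ _).inv ≫ nf ▷ g' ≫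
      (α_ _ _ _).hom) {j : H.map k ⟶ H.map f ≫ H.map g} {j' : H.map k' ⟶ H.map f' ≫ H.map g'}
    (hj : j = H.map₂ i ≫ (H.mapComp f g).hom) (hj' : j' = H.map₂ i' ≫ (H.mapComp f' g').hom) :
    mapSq H nk ≫ H.map p ◁ j' = j ▷ H.map r ≫ (α_ _ _ _).hom ≫ H.map f ◁ mapSq H ng ≫
      (α_ _ _ _).inv ≫ mapSq H nf ▷ H.map g' ≫ (α_ _ _ _).hom := by
  subst hj hj'
  have h' := congrArg H.map₂ h
  simp only [PrelaxFunctor.map₂_comp, Pseudofunctor.map₂_whisker_right,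
    Pseudofunctor.map₂_whisker_left, Category.assoc] at h'
  rw [← Category.assoc, ← Category.assoc, Iso.comp_inv_eq] at h'
  simp only [Category.assoc] at h'
  simp only [mapSq, whiskerLeft_comp, comp_whiskerRight, Category.assoc]
  rw [reassoc_of% h', Iso.inv_hom_id_assoc]
  congr 1
  rw [reassoc_of% map_assoc_hom H f g r, reassoc_of% map_assoc_inv H f q g',
    reassoc_of% map_assoc_hom H p f' g', ← whiskerLeft_comp, Iso.inv_hom_id, whiskerLeft_id,
    Category.comp_id]

theorem map₂_id_comp {a b : B} (f : a ⟶ b) {k : H.obj a ⟶ H.obj b} (X : H.map f ⟶ k) :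
    X = H.map₂ (𝟙 f) ≫ X := by
  rw [PrelaxFunctor.map₂_id, Category.id_comp]

theorem map₂_comp_comp {a b : B} {f g h : a ⟶ b} (β : f ⟶ g) (γ : g ⟶ h)
    {k : H.obj a ⟶ H.obj b} (X : H.map h ⟶ k) :
    H.map₂ (β ≫ γ) ≫ X = H.map₂ β ≫ H.map₂ γ ≫ X := by
  rw [PrelaxFunctor.map₂_comp, Category.assoc]

end Aux

variable {B : Type u₁} [Bicategory.{c₁, v₁} B] {C : Type u₂} [Bicategory.{c₂, v₂} C]

/-- Oplax natural transformations between pseudofunctors. -/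
abbrev Opl (F G : B ⥤ᵖ C) := Oplax.OplaxTrans F.toOplax G.toOplax

variable {F : B ⥤ᵖ C} {G : C ⥤ᵖ B}

/-- The whiskering `F * η : F ⟶ F G F` of an oplax transformation `η : 1 ⟶ G F`. -/
def unitPost (η : Opl (Pseudofunctor.id B) (F.comp G)) : Opl F ((F.comp G).comp F) where
  app x := F.map (η.app x)
  naturality m := mapSq F (η.naturality m)
  naturality_naturality β := post_naturality F (η.naturality_naturality β)
  naturality_id x := post_id F (η.naturality_id x) (map₂_id_comp F _ _) rfl
  naturality_comp f g := post_comp F (η.naturality_comp f g) (map₂_id_comp F _ _) rfl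

/-- The whiskering `θ * F : F G F ⟶ F` of an oplax transformation `θ : F G ⟶ 1`. -/
def counitPre (θ : Opl (G.comp F) (Pseudofunctor.id C)) : Opl ((F.comp G).comp F) F where
  app x := θ.app (F.obj x)
  naturality m := θ.naturality (F.map m)
  naturality_naturality β := θ.naturality_naturality (F.map₂ β)
  naturality_id x := pre_id (θ.naturality_naturality (F.mapId x).hom)
    (θ.naturality_id (F.obj x)) (map₂_comp_comp F _ _ _) (Category.comp_id _).symm
  naturality_comp f g := pre_comp (θ.naturality_naturality (F.mapComp f g).hom)
    (θ.naturality_comp (F.map f) (F.map g)) (map₂_comp_comp F _ _ _) (Category.comp_id _).symm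

/-- The whiskering `η * G : G ⟶ G F G` of an oplax transformation `η : 1 ⟶ G F`. -/
def unitPre (η : Opl (Pseudofunctor.id B) (F.comp G)) : Opl G ((G.comp F).comp G) where
  app y := η.app (G.obj y)
  naturality n := η.naturality (G.map n)
  naturality_naturality β := η.naturality_naturality (G.map₂ β)
  naturality_id x := pre_id (η.naturality_naturality (G.mapId x).hom)
    (η.naturality_id (G.obj x)) (Category.comp_id _).symm (map₂_comp_comp G _ _ _)
  naturality_comp f g := pre_comp (η.naturality_naturality (G.mapComp f g).hom)
    (η.naturality_comp (G.map f) (G.map g)) (Category.comp_id _).symm (map₂_comp_comp G _ _ _)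

/-- The whiskering `G * θ : G F G ⟶ G` of an oplax transformation `θ : F G ⟶ 1`. -/
def counitPost (θ : Opl (G.comp F) (Pseudofunctor.id C)) : Opl ((G.comp F).comp G) G where
  app y := G.map (θ.app y)
  naturality n := mapSq G (θ.naturality n)
  naturality_naturality β := post_naturality G (θ.naturality_naturality β)
  naturality_id x := post_id G (θ.naturality_id x) rfl (map₂_id_comp G _ _)
  naturality_comp f g := post_comp G (θ.naturality_comp f g) rfl (map₂_id_comp G _ _)

section

open scoped Oplax.OplaxTrans

/-- The composite oplax transformation `(F * η) ≫ (θ * F) : F ⟶ F G F ⟶ F`. -/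
def leftZigzag (η : Opl (Pseudofunctor.id B) (F.comp G)) (θ : Opl (G.comp F) (Pseudofunctor.id C)) :
    F.toOplax ⟶ F.toOplax :=
  Oplax.OplaxTrans.vcomp (unitPost η) (counitPre θ)

/-- The composite oplax transformation `(η * G) ≫ (G * θ) : G ⟶ G F G ⟶ G`. -/
def rightZigzag (η : Opl (Pseudofunctor.id B) (F.comp G))
    (θ : Opl (G.comp F) (Pseudofunctor.id C)) : G.toOplax ⟶ G.toOplax :=
  Oplax.OplaxTrans.vcomp (unitPre η) (counitPost θ)

end

end LaxAdj

open scoped Oplax.OplaxTrans in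
/-- A lax adjunction between pseudofunctors `F : B ⟶ C` and `G : C ⟶ B`: oplax natural
transformations `η : 1 ⟶ G F` (the unit) and `θ : F G ⟶ 1` (the counit) and invertible
modifications `s : 1 ≅ (F * η) ≫ (θ * F)` and `t : (η * G) ≫ (G * θ) ≅ 1` (the triangulators)
satisfying the two swallowtail identities.

The first swallowtail identity says that the composite
`η_x ⟶ η_x ≫ (η_{GFx} ≫ G θ_{Fx}) ⟶ (η_x ≫ GF η_x) ≫ G θ_{Fx} ⟶ η_x ≫ G (F η_x ≫ θ_{Fx}) ⟶ η_x`
of `t_{Fx}⁻¹`, the naturality comparison of `η` at `η_x`, and `G s_x⁻¹` is the identity, and the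
second says that the composite
`θ_y ⟶ F (η_{Gy} ≫ G θ_y) ≫ θ_y ⟶ F η_{Gy} ≫ (FG θ_y ≫ θ_y) ⟶ (F η_{Gy} ≫ θ_{FGy}) ≫ θ_y ⟶ θ_y`
of `F t_y⁻¹`, the naturality comparison of `θ` at `θ_y`, and `s_{Gy}⁻¹` is the identity. -/
structure LaxAdjunction {B : Type u₁} [Bicategory.{c₁, v₁} B] {C : Type u₂}
    [Bicategory.{c₂, v₂} C] (F : B ⥤ᵖ C) (G : C ⥤ᵖ B) where
  /-- the unit -/
  unit : LaxAdj.Opl (Pseudofunctor.id B) (F.comp G)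
  /-- the counit -/
  counit : LaxAdj.Opl (G.comp F) (Pseudofunctor.id C)
  /-- the first triangulator -/
  s : 𝟙 F.toOplax ≅ LaxAdj.leftZigzag unit counit
  /-- the second triangulator -/
  t : LaxAdj.rightZigzag unit counit ≅ 𝟙 G.toOplax
  swallowtail_unit : ∀ x : B,
    (ρ_ (unit.app x)).inv ≫ unit.app x ◁ t.inv.as.app (F.obj x) ≫
      (α_ (unit.app x) (unit.app (G.obj (F.obj x))) (G.map (counit.app (F.obj x)))).inv ≫
      unit.naturality (unit.app x) ▷ G.map (counit.app (F.obj x)) ≫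
      (α_ (unit.app x) (G.map (F.map (unit.app x))) (G.map (counit.app (F.obj x)))).hom ≫
      unit.app x ◁ ((G.mapComp (F.map (unit.app x)) (counit.app (F.obj x))).inv ≫
        G.map₂ (s.inv.as.app x) ≫ (G.mapId (F.obj x)).hom) ≫
      (ρ_ (unit.app x)).hom = 𝟙 (unit.app x)
  swallowtail_counit : ∀ y : C,
    (λ_ (counit.app y)).inv ≫
      ((F.mapId (G.obj y)).inv ≫ F.map₂ (t.inv.as.app y) ≫
        (F.mapComp (unit.app (G.obj y)) (G.map (counit.app y))).hom) ▷ counit.app y ≫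
      (α_ (F.map (unit.app (G.obj y))) (F.map (G.map (counit.app y))) (counit.app y)).hom ≫
      F.map (unit.app (G.obj y)) ◁ counit.naturality (counit.app y) ≫
      (α_ (F.map (unit.app (G.obj y))) (counit.app (F.obj (G.obj y))) (counit.app y)).inv ≫
      s.inv.as.app (G.obj y) ▷ counit.app y ≫
      (λ_ (counit.app y)).hom = 𝟙 (counit.app y)

/-- A lax adjunction is a biadjunction if its unit and counit are pseudo natural, i.e. if their
naturality comparisons are invertible. -/
structure LaxAdjunction.IsBiadjunction {B : Type u₁} [Bicategory.{c₁, v₁} B] {C : Type u₂}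
    [Bicategory.{c₂, v₂} C] {F : B ⥤ᵖ C} {G : C ⥤ᵖ B} (A : LaxAdjunction F G) : Prop where
  isIso_unit : ∀ {x y : B} (m : x ⟶ y), IsIso (A.unit.naturality m)
  isIso_counit : ∀ {x y : C} (n : x ⟶ y), IsIso (A.counit.naturality n)

/-! ## Calculus of cells -/

namespace DoubleCategory

section Cells

variable {D : Type u} [CellCategory.{c, p, v} D]

/-! The unit of a companion `f_!` controls every globular cell out of a composite ending in `f_!`.
Inserting the unit on the right of `m` gives a cell from `m` to `m ⊙ f_!`, and pasting that
insertion with the counit gives back the identity. So a globular cell out of `m ⊙ f_!` is determined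
by its composite with the insertion (`insertRight_cancel`). In particular `α_!` is the only globular
cell `φ` such that inserting the unit of `g_!` and then applying `φ` equals pasting the unit of
`f_!` with `α` (`isTransposeCell_slide`). This characterisation, `IsTransposeCell`, involves no
counits, and it is stable under vertical composition, external composition and double functors.

Every equation between globular cells is therefore checked after inserting units, where it becomes
an equation of the double adjunction. The oplax axioms reduce to naturality of the cells `α_m` and
their compatibility with `⊙` and `id`. Companions compose and are preserved by double functors, so
the components of the two zigzags are companions of `F η_x ≫ ε_{Fx}` and `η_{Gy} ≫ G ε_y`. These
arrows are identities by the triangle identities, and a companion of an identity is isomorphic to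
`id` (`Companion.isoHid`); this gives the triangulators. The modification axiom says that the
comparison of a zigzag at a proarrow transposes an identity cell, which is the triangle identity on
proarrows. Each swallowtail reduces, after the unit of `η_x` or `ε_y` is inserted, to naturality of
`η` or `ε` at that unit cell (`mapUnit_vcomp_appPro`), after which the triangulators cancel.

Commuters need no further argument: being a commuter means that the comparison is invertible. -/

theorem vcomp_eq_assoc {x y w z a b a' b' : D} {m : Pro x y} {n : Pro w z} {k : Pro a b}
    {l : Pro a' b'} {α : Cell m n} {β : Cell n k} {γ : Cell m k} (h : α ⋆ β = γ)
    (δ : Cell k l) : α ⋆ β ⋆ δ = γ ⋆ δ := by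
  rw [← vcomp_assoc, h]

theorem vcomp_eq_vcomp_assoc {x y w z a b a' b' s t : D} {m : Pro x y} {n : Pro w z}
    {n' : Pro s t} {k : Pro a b}
    {l : Pro a' b'} {α : Cell m n} {β : Cell n k} {α' : Cell m n'} {β' : Cell n' k}
    (h : α ⋆ β = α' ⋆ β') (δ : Cell k l) : α ⋆ β ⋆ δ = α' ⋆ β' ⋆ δ := by
  rw [← vcomp_assoc, h, vcomp_assoc]

end Cells

/-! ### Unitors and associators against cells with arbitrary boundary arrows. -/

section Calculus

variable {D : Type u} [CellCategory.{c, p, v} D] [DoubleCategory D]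

theorem hcell_vcomp_hcell {x y z x' y' z' x'' y'' z'' : D} {m : Pro x y} {n : Pro y z}
    {m' : Pro x' y'} {n' : Pro y' z'} {m'' : Pro x'' y''} {n'' : Pro y'' z''}
    (α : Cell m m') (α' : Cell m' m'') (β : Cell n n') (β' : Cell n' n'')
    (h : tgt α = src β) (h' : tgt α' = src β') :
    hcell α β h ⋆ hcell α' β' h' =
      hcell (α ⋆ α') (β ⋆ β') (by rw [tgt_vcomp, src_vcomp, h, h']) :=
  (hcell_vcomp _ _ _ _ _ _ _).symm

theorem cellOf_wl {x y z : D} (m : Pro x y) {n n' : Pro y z} (β : n ⟶ n') :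
    cellOf (wl m β) = hcell (vid m) (cellOf β) (by simp) := rfl

theorem cellOf_wr {x y z : D} {m m' : Pro x y} (α : m ⟶ m') (n : Pro y z) :
    cellOf (wr α n) = hcell (cellOf α) (vid n) (by simp) := rfl

/-- The boundary arrow is a free variable `f` with an equation, so that the lemma applies when the
source is only propositionally equal to the arrow in the goal. -/
theorem vcomp_lunit_inv {x y x' y' : D} {m : Pro x y} {m' : Pro x' y'} (α : Cell m m')
    {f : x ⟶ x'} (hf : src α = f) (h : tgt (hidCell f) = src α) :
    α ⋆ cellOf (lunit m').inv = cellOf (lunit m).inv ⋆ hcell (hidCell f) α h := by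
  subst hf
  have e := congrArg (fun γ => cellOf (lunit m).inv ⋆ γ ⋆ cellOf (lunit m').inv)
    (lunit_naturality α h)
  simpa using e.symm

theorem vcomp_runit_inv {x y x' y' : D} {m : Pro x y} {m' : Pro x' y'} (α : Cell m m')
    {f : y ⟶ y'} (hf : tgt α = f) (h : tgt α = src (hidCell f)) :
    α ⋆ cellOf (runit m').inv = cellOf (runit m).inv ⋆ hcell α (hidCell f) h := by
  subst hf
  have e := congrArg (fun γ => cellOf (runit m).inv ⋆ γ ⋆ cellOf (runit m').inv)
    (runit_naturality α h)
  simpa using e.symm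

theorem hcell_hidCell_vcomp_runit {x y x' y' : D} {m : Pro x y} {m' : Pro x' y'}
    (α : Cell m m') {f : y ⟶ y'} (hf : tgt α = f) (h : tgt α = src (hidCell f)) :
    hcell α (hidCell f) h ⋆ cellOf (runit m').hom = cellOf (runit m).hom ⋆ α := by
  subst hf
  exact runit_naturality α h

theorem hidCell_hcell_vcomp_lunit {x y x' y' : D} {m : Pro x y} {m' : Pro x' y'}
    (α : Cell m m') {f : x ⟶ x'} (hf : src α = f) (h : tgt (hidCell f) = src α) :
    hcell (hidCell f) α h ⋆ cellOf (lunit m').hom = cellOf (lunit m).hom ⋆ α := by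
  subst hf
  exact lunit_naturality α h

/-- When the boundary arrow is an identity, `hidCell` can be traded for `vid`, the form that
interchange with other identity cells requires. -/
theorem vcomp_lunit_inv_of_src {x y y' : D} {m : Pro x y} {m' : Pro x y'} (α : Cell m m')
    (hα : src α = 𝟙 x) (h : tgt (vid (hid x)) = src α) :
    α ⋆ cellOf (lunit m').inv = cellOf (lunit m).inv ⋆ hcell (vid (hid x)) α h := by
  rw [vcomp_lunit_inv α hα (by simp [hα])]
  congr 1
  exact hcell_congr (by simp) rfl _ _

theorem vcomp_runit_inv_of_tgt {x y x' : D} {m : Pro x y} {m' : Pro x' y} (α : Cell m m')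
    (hα : tgt α = 𝟙 y) (h : tgt α = src (vid (hid y))) :
    α ⋆ cellOf (runit m').inv = cellOf (runit m).inv ⋆ hcell α (vid (hid y)) h := by
  rw [vcomp_runit_inv α hα (by simp [hα])]
  congr 1
  exact hcell_congr rfl (by simp) _ _

theorem hcell_vcomp_runit_of_tgt {x y x' : D} {m : Pro x y} {m' : Pro x' y} (α : Cell m m')
    (hα : tgt α = 𝟙 y) (h : tgt α = src (vid (hid y))) :
    hcell α (vid (hid y)) h ⋆ cellOf (runit m').hom = cellOf (runit m).hom ⋆ α := by
  rw [← hcell_hidCell_vcomp_runit α hα (by simp [hα])]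
  congr 1
  exact hcell_congr rfl (by simp) _ _

theorem hcell_vcomp_lunit_of_src {x y y' : D} {m : Pro x y} {m' : Pro x y'} (α : Cell m m')
    (hα : src α = 𝟙 x) (h : tgt (vid (hid x)) = src α) :
    hcell (vid (hid x)) α h ⋆ cellOf (lunit m').hom = cellOf (lunit m).hom ⋆ α := by
  rw [← hidCell_hcell_vcomp_lunit α hα (by simp [hα])]
  congr 1
  exact hcell_congr (by simp) rfl _ _

theorem hcell_assoc_inv {x y z w x' y' z' w' : D} {m : Pro x y} {n : Pro y z} {k : Pro z w}
    {m' : Pro x' y'} {n' : Pro y' z'} {k' : Pro z' w'}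
    (α : Cell m m') (β : Cell n n') (γ : Cell k k') (h : tgt α = src β) (h' : tgt β = src γ)
    (h₁ : tgt (hcell α β h) = src γ) (h₂ : tgt α = src (hcell β γ h')) :
    hcell α (hcell β γ h') h₂ ⋆ cellOf (assoc' m' n' k').inv =
      cellOf (assoc' m n k).inv ⋆ hcell (hcell α β h) γ h₁ := by
  have e := congrArg (fun δ => cellOf (assoc' m n k).inv ⋆ δ ⋆ cellOf (assoc' m' n' k').inv)
    (assoc_naturality α β γ h h' h₁ h₂)
  simpa using e.symm

/-- This and the next five lemmas are consequences of the pentagon and triangle, read off from the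
bicategory `UBicat D`. -/
theorem lunit_hid_eq_runit_hid (x : D) : (lunit (hid x)) = runit (hid x) :=
  Iso.ext (Bicategory.unitors_equal (B := UBicat D) (a := ⟨x⟩))

theorem runit_hcomp {x y z : D} (m : Pro x y) (n : Pro y z) :
    (runit (m ⊙ n)).hom = (assoc' m n (hid z)).hom ≫ wl m (runit n).hom :=
  Bicategory.rightUnitor_comp (B := UBicat D) (a := ⟨x⟩) (b := ⟨y⟩) (c := ⟨z⟩) m n

theorem runit_hcomp_inv {x y z : D} (m : Pro x y) (n : Pro y z) :
    (runit (m ⊙ n)).inv = wl m (runit n).inv ≫ (assoc' m n (hid z)).inv :=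
  Bicategory.rightUnitor_comp_inv (B := UBicat D) (a := ⟨x⟩) (b := ⟨y⟩) (c := ⟨z⟩) m n

theorem lunit_hcomp {x y z : D} (m : Pro x y) (n : Pro y z) :
    (lunit (m ⊙ n)).hom = (assoc' (hid x) m n).inv ≫ wr (lunit m).hom n :=
  Bicategory.leftUnitor_comp (B := UBicat D) (a := ⟨x⟩) (b := ⟨y⟩) (c := ⟨z⟩) m n

theorem lunit_hcomp_inv {x y z : D} (m : Pro x y) (n : Pro y z) :
    (lunit (m ⊙ n)).inv = wr (lunit m).inv n ≫ (assoc' (hid x) m n).hom :=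
  Bicategory.leftUnitor_comp_inv (B := UBicat D) (a := ⟨x⟩) (b := ⟨y⟩) (c := ⟨z⟩) m n

theorem wl_lunit_inv {x y z : D} (m : Pro x y) (n : Pro y z) :
    wl m (lunit n).inv ≫ (assoc' m (hid y) n).inv = wr (runit m).inv n :=
  Bicategory.triangle_assoc_comp_left_inv (B := UBicat D) (a := ⟨x⟩) (b := ⟨y⟩) (c := ⟨z⟩) m n

/-! ### Inserting the unit of a companion. -/

/-- Inserting on the right of a proarrow a cell `u` out of an external identity, such as the unit
of a companion. -/
def insertRight {x y z : D} (m : Pro x y) {q : Pro y z} (u : Cell (hid y) q)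
    (hu : src u = 𝟙 y) : Cell m (m ⊙ q) :=
  cellOf (runit m).inv ⋆ hcell (vid m) u (by simp [hu])

@[simp] theorem src_insertRight {x y z : D} (m : Pro x y) {q : Pro y z} (u : Cell (hid y) q)
    (hu : src u = 𝟙 y) : src (insertRight m u hu) = 𝟙 x := by
  simp [insertRight]

@[simp] theorem tgt_insertRight {x y z : D} (m : Pro x y) {q : Pro y z} (u : Cell (hid y) q)
    (hu : src u = 𝟙 y) : tgt (insertRight m u hu) = tgt u := by
  simp [insertRight]

theorem insertRight_congr {x y z : D} (m : Pro x y) {q : Pro y z} {u u' : Cell (hid y) q}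
    (h : u = u') (hu : src u = 𝟙 y) (hu' : src u' = 𝟙 y) :
    insertRight m u hu = insertRight m u' hu' := by
  subst h; rfl

theorem insertRight_vid {x y : D} (m : Pro x y) (h : src (vid (hid y)) = 𝟙 y) :
    insertRight m (vid (hid y)) h = cellOf (runit m).inv := by
  simp [insertRight]

theorem insertRight_vcomp_wr {x y z : D} {m n : Pro x y} {q : Pro y z} (u : Cell (hid y) q)
    (hu : src u = 𝟙 y) (φ : m ⟶ n) :
    insertRight m u hu ⋆ cellOf (wr φ q) = cellOf φ ⋆ insertRight n u hu := by
  unfold insertRight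
  rw [vcomp_eq_vcomp_assoc (vcomp_runit_inv_of_tgt (cellOf φ) (by simp) (by simp)),
    vcomp_assoc, cellOf_hglob, hcell_vcomp_hcell, hcell_vcomp_hcell]
  congr 1
  exact hcell_congr (by simp) (by simp) _ _

theorem insertRight_vcomp_wl {x y z : D} (m : Pro x y) {q q' : Pro y z} (u : Cell (hid y) q)
    (hu : src u = 𝟙 y) (φ : q ⟶ q') :
    insertRight m u hu ⋆ cellOf (wl m φ) = insertRight m (u ⋆ cellOf φ) (by simp [hu]) := by
  unfold insertRight
  rw [vcomp_assoc, cellOf_hglob, hcell_vcomp_hcell]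
  congr 1
  exact hcell_congr (by simp) (by simp) _ _

theorem insertRight_vcomp {x y z w : D} (m : Pro x y) {q : Pro y z} {r : Pro y w}
    (u : Cell (hid y) q) (hu : src u = 𝟙 y) (α : Cell q r) (hα : src α = 𝟙 y)
    (h : tgt (vid m) = src α) :
    insertRight m (u ⋆ α) (by simp [hu, hα]) = insertRight m u hu ⋆ hcell (vid m) α h := by
  unfold insertRight
  rw [vcomp_assoc, hcell_vcomp_hcell]
  congr 1
  exact hcell_congr (by simp) (by simp) _ _

/-- By coherence, the right unitor of `m ⊙ n` is that of `n` whiskered by `m`; insertion at the end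
of a composite thus only touches the last factor. -/
theorem insertRight_vcomp_assoc {x y z w : D} (m : Pro x y) (n : Pro y z) {q : Pro z w}
    (u : Cell (hid z) q) (hu : src u = 𝟙 z) (h : tgt (vid m) = src (insertRight n u hu)) :
    insertRight (m ⊙ n) u hu ⋆ cellOf (assoc' m n q).hom =
      hcell (vid m) (insertRight n u hu) h := by
  have e : hcell (vid m) (insertRight n u hu) h =
      cellOf (wl m (runit n).inv) ⋆ hcell (vid m) (hcell (vid n) u (by simp [hu])) (by simp) := by
    rw [cellOf_hglob, hcell_vcomp_hcell]
    exact hcell_congr (by simp) rfl _ _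
  rw [e]
  unfold insertRight
  rw [vcomp_assoc, runit_hcomp_inv, ← hcell_congr (hcell_vid m n (by simp)) (rfl : u = u)
    (by simp [hu]) (by simp [hu]), assoc_naturality _ _ _ _ (by simp [hu]) _ (by simp)]
  simp

/-- The inserted cell on the right has the shape of the unit of a composite companion, so inserting
that unit can be done one companion at a time. -/
theorem insertRight_insertRight {x y z w : D} (m : Pro x y) {q : Pro y z} {r : Pro z w}
    (u : Cell (hid y) q) (hu : src u = 𝟙 y) (u' : Cell (hid z) r) (hu' : src u' = 𝟙 z) :
    insertRight m u hu ⋆ insertRight (m ⊙ q) u' hu' ⋆ cellOf (assoc' m q r).hom =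
      insertRight m (u ⋆ insertRight q u' hu') (by simp [hu]) := by
  rw [insertRight_vcomp_assoc _ _ _ _ (by simp), insertRight_vcomp _ _ _ _ (by simp)]

theorem insertRight_hid {x z : D} {q : Pro x z} (u : Cell (hid x) q) (hu : src u = 𝟙 x) :
    insertRight (hid x) u hu ⋆ cellOf (lunit q).hom = u := by
  unfold insertRight
  rw [vcomp_assoc, hcell_vcomp_lunit_of_src u hu, lunit_hid_eq_runit_hid, inv_vcomp_hom_assoc]

theorem vcomp_insertRight {x y z w a : D} {m : Pro x y} {n : Pro w z} (α : Cell m n)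
    {g : y ⟶ z} (hα : tgt α = g) {q : Pro z a} (u : Cell (hid z) q) (hu : src u = 𝟙 z)
    (h : tgt α = src (hidCell g ⋆ u)) :
    α ⋆ insertRight n u hu = cellOf (runit m).inv ⋆ hcell α (hidCell g ⋆ u) h := by
  unfold insertRight
  rw [vcomp_eq_vcomp_assoc (vcomp_runit_inv α hα (by simp [hα])), hcell_vcomp_hcell]
  congr 1
  exact hcell_congr (by simp) rfl _ _

/-- This is the equation `unit ⊙ counit = 1` whiskered by `m`; the triangle axiom absorbs the
unitors. -/
theorem insertRight_hcell_counit {x y z : D} (m : Pro x y) {f : y ⟶ z} (cf : Companion f)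
    (h : tgt (insertRight m cf.unit cf.src_unit) = src cf.counit) :
    hcell (insertRight m cf.unit cf.src_unit) cf.counit h ⋆ cellOf (runit (m ⊙ cf.pro)).hom =
      vid (m ⊙ cf.pro) := by
  have huc : tgt cf.unit = src cf.counit := cf.tgt_unit.trans cf.src_counit.symm
  have hm : tgt (vid m) = src cf.unit := by simp [cf.src_unit]
  have e : hcell (insertRight m cf.unit cf.src_unit) cf.counit h =
      cellOf (wr (runit m).inv cf.pro) ⋆ hcell (hcell (vid m) cf.unit hm) cf.counit
        (by simp [huc]) := by
    rw [cellOf_hglob, hcell_vcomp_hcell]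
    exact hcell_congr rfl (by simp) _ _
  have e' := cf.unit_hcell_counit huc
  rw [e, runit_hcomp, cellOf_comp, vcomp_assoc,
    vcomp_eq_vcomp_assoc (assoc_naturality _ _ _ _ huc _ (by simp [cf.src_unit])),
    cellOf_wl, hcell_vcomp_hcell, hcell_congr (vcomp_vid _) e' _ (by simp)]
  have t := triangle_glob m cf.pro
  have t' := congrArg (fun γ => cellOf (wr (runit m).inv cf.pro) ⋆ cellOf γ) t
  simp only [cellOf_comp, cellOf_hglob] at t'
  rw [← cellOf_hglob] at t'
  refine t'.trans ?_
  rw [← cellOf_hglob, ← cellOf_comp, ← hglob_comp]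
  simp

/-- Inserting the unit of a companion is epi with respect to globular cells. -/
theorem insertRight_cancel {x y z : D} {m : Pro x y} {f : y ⟶ z} (cf : Companion f)
    {k : Pro x z} {φ ψ : m ⊙ cf.pro ⟶ k}
    (h : insertRight m cf.unit cf.src_unit ⋆ cellOf φ =
      insertRight m cf.unit cf.src_unit ⋆ cellOf ψ) : φ = ψ := by
  have huc : tgt (insertRight m cf.unit cf.src_unit) = src cf.counit := by
    simp [cf.tgt_unit, cf.src_counit]
  -- Any `χ` is recovered from its composite with the insertion by pasting with the counit: by
  -- interchange the counit meets the inserted unit first, and `χ` is left beside an identity.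
  have key : ∀ χ : m ⊙ cf.pro ⟶ k, cellOf χ =
      hcell (insertRight m cf.unit cf.src_unit ⋆ cellOf χ) cf.counit (by simpa using huc) ⋆
        cellOf (runit k).hom := fun χ => by
    have e : hcell (insertRight m cf.unit cf.src_unit ⋆ cellOf χ) cf.counit (by simpa using huc) =
        hcell (insertRight m cf.unit cf.src_unit) cf.counit huc ⋆
          hcell (cellOf χ) (vid (hid z)) (by simp) := by
      rw [hcell_vcomp_hcell]
      exact hcell_congr rfl (by simp) _ _
    rw [e, vcomp_assoc, hcell_vcomp_runit_of_tgt _ (by simp), ← vcomp_assoc,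
      insertRight_hcell_counit, vid_vcomp]
  apply glob_ext
  rw [key φ, key ψ]
  congr 1
  exact hcell_congr h rfl _ _

/-- The unit of a companion is epi with respect to globular cells. -/
theorem unit_cancel {y z : D} {f : y ⟶ z} (cf : Companion f) {k : Pro y z} {φ ψ : cf.pro ⟶ k}
    (h : cf.unit ⋆ cellOf φ = cf.unit ⋆ cellOf ψ) : φ = ψ := by
  rw [← cancel_epi (lunit cf.pro).hom]
  apply insertRight_cancel
  rw [cellOf_comp, cellOf_comp, vcomp_eq_assoc (insertRight_hid _ _),
    vcomp_eq_assoc (insertRight_hid _ _), h]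

/-! ### Transposes characterised by units alone. -/

/-- A globular cell `φ : m ⊙ q ⟶ p ⊙ n` is a transpose of a cell `α : Cell m n` with respect to
cells `u : Cell id p` and `u' : Cell id q`, in practice units of companions, if the composite of
`u'` with `φ` is that of `u` with `α`. -/
def IsTransposeCell {x y w z : D} {p : Pro x w} {q : Pro y z} (u : Cell (hid x) p)
    (u' : Cell (hid y) q) (hu' : src u' = 𝟙 y) {m : Pro x y} {n : Pro w z} (α : Cell m n)
    (φ : m ⊙ q ⟶ p ⊙ n) : Prop :=
  ∀ h : tgt u = src α, insertRight m u' hu' ⋆ cellOf φ = cellOf (lunit m).inv ⋆ hcell u α h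

/-- The inserted unit of `g_!` meets the counit built into `slide`, and `unit ⋆ counit = hidCell g`
makes both disappear into a unitor. -/
theorem isTransposeCell_slide {x y w z : D} {f : x ⟶ w} {g : y ⟶ z} (cf : Companion f)
    (cg : Companion g) {m : Pro x y} {n : Pro w z} (α : Cell m n) (hs : src α = f)
    (ht : tgt α = g) :
    IsTransposeCell cf.unit cg.unit cg.src_unit α (slide cf cg α hs ht) := fun h => by
  unfold slide
  have h₂ : tgt (hcell cf.unit α h) = src cg.counit := by simp [ht, cg.src_counit]
  rw [cellOf_comp, cellOf_comp, vcomp_eq_vcomp_assoc (insertRight_vcomp_wr _ _ _)]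
  have e : insertRight (hid x ⊙ m) cg.unit cg.src_unit ⋆ hcell (hcell cf.unit α h) cg.counit h₂ ⋆
      cellOf (runit (cf.pro ⊙ n)).hom = hcell cf.unit α h := by
    unfold insertRight
    rw [vcomp_assoc, vcomp_eq_assoc (hcell_vcomp_hcell _ _ _ _ _ _),
      hcell_congr (vid_vcomp _) cg.unit_vcomp_counit _ (by simp [ht]),
      hcell_hidCell_vcomp_runit _ (by simp [ht]), inv_vcomp_hom_assoc]
  exact congrArg _ e

/-- When the unit cells are themselves globular and `α` is an identity, the transpose condition is
the modification axiom. Since `α` will be an identity only by a triangle identity, that is an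
equation and not built into the type. -/
theorem isTransposeCell_globular {x y : D} {p : Pro x x} {q : Pro y y} {u : Cell (hid x) p}
    {u' : Cell (hid y) q} {hu' : src u' = 𝟙 y} {m : Pro x y} {α : Cell m m} (hα : α = vid m)
    {φ : m ⊙ q ⟶ p ⊙ m} (h : IsTransposeCell u u' hu' α φ) (s : hid x ⟶ p) (s' : hid y ⟶ q)
    (hs : cellOf s = u) (hs' : cellOf s' = u') :
    wl m s' ≫ φ = ((runit m).hom ≫ (lunit m).inv) ≫ wr s m := by
  subst hs hs' hα
  have e := h (by simp)
  apply glob_ext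
  have e' := congrArg (fun γ => cellOf (runit m).hom ⋆ γ) e
  unfold insertRight at e'
  rw [vcomp_assoc, hom_vcomp_inv_assoc] at e'
  rw [cellOf_comp, cellOf_comp, cellOf_comp, vcomp_assoc]
  exact e'

/-- The globular composite is the comparison of a vertical composite of oplax transformations, and
the new unit cells are those of `Companion.comp`; this computes the comparisons of the zigzags. -/
theorem IsTransposeCell.comp {x y x' y' x'' y'' : D} {p : Pro x x'} {q : Pro y y'}
    {p' : Pro x' x''} {q' : Pro y' y''} {u : Cell (hid x) p} {u₁ : Cell (hid y) q}
    {u' : Cell (hid x') p'} {u₁' : Cell (hid y') q'} {hu₁ : src u₁ = 𝟙 y} {hu' : src u' = 𝟙 x'}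
    {hu₁' : src u₁' = 𝟙 y'} {m : Pro x y} {n : Pro x' y'} {k : Pro x'' y''} {α : Cell m n}
    {β : Cell n k} {φ : m ⊙ q ⟶ p ⊙ n} {ψ : n ⊙ q' ⟶ p' ⊙ k}
    (hα : tgt u = src α) (hβ : tgt u' = src β)
    (hφ : IsTransposeCell u u₁ hu₁ α φ) (hψ : IsTransposeCell u' u₁' hu₁' β ψ) :
    IsTransposeCell (u ⋆ insertRight p u' hu') (u₁ ⋆ insertRight q u₁' hu₁') (by simp [hu₁])
      (α ⋆ β) ((assoc' m q q').inv ≫ wr φ q' ≫ (assoc' p n q').hom ≫ wl p ψ ≫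
        (assoc' p p' k).inv) := fun h => by
  simp only [cellOf_comp]
  rw [← insertRight_insertRight m u₁ hu₁ u₁' hu₁']
  simp only [vcomp_assoc]
  rw [hom_vcomp_inv_assoc, vcomp_eq_vcomp_assoc (insertRight_vcomp_wr _ _ _),
    vcomp_eq_vcomp_assoc (hφ hα), vcomp_eq_assoc (insertRight_vcomp_assoc _ _ _ _ (by simp))]
  have e : hcell (vid p) (insertRight n u₁' hu₁') (by simp) ⋆ cellOf (wl p ψ) ⋆
      cellOf (assoc' p p' k).inv = hcell (insertRight p u' hu') β (by simp [hβ]) := by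
    rw [cellOf_wl, vcomp_eq_assoc (hcell_vcomp_hcell _ _ _ _ _ _),
      hcell_congr (vid_vcomp _) (hψ hβ) _ (by simp [hu'])]
    have e₁ : hcell (vid p) (cellOf (lunit n).inv ⋆ hcell u' β hβ) (by simp [hu']) =
        cellOf (wl p (lunit n).inv) ⋆ hcell (vid p) (hcell u' β hβ) (by simp [hu']) := by
      rw [cellOf_hglob, hcell_vcomp_hcell]
      exact hcell_congr (by simp) rfl _ _
    rw [e₁, vcomp_assoc, hcell_assoc_inv _ _ _ (by simp [hu']) hβ (by simp [hβ]),
      ← vcomp_assoc, ← cellOf_comp, wl_lunit_inv, cellOf_hglob, hcell_vcomp_hcell]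
    exact hcell_congr rfl (by simp) _ _
  rw [e, hcell_vcomp_hcell]

/-- A commuting square of `α` with cells out of identities lets the inserted `u'` be exchanged for
`v'`: both sides become `u` pasted with `v ⋆ α`. In the swallowtails `e` is naturality at the unit
of a companion. -/
theorem IsTransposeCell.insertRight_square {x y w z : D} {p : Pro x w} {q : Pro y z}
    {u : Cell (hid x) p} {u' : Cell (hid y) q} {hu' : src u' = 𝟙 y} {m : Pro x y} {n : Pro w z}
    {α : Cell m n} {φ : m ⊙ q ⟶ p ⊙ n} (hφ : IsTransposeCell u u' hu' α φ) {f : x ⟶ w}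
    (hf : tgt u = f) (hα : src α = f)
    {v : Cell (hid x) m} (hv : src v = 𝟙 x) {v' : Cell (hid w) n} (hv' : src v' = 𝟙 w)
    (e : v ⋆ α = hidCell f ⋆ v') :
    v ⋆ insertRight m u' hu' ⋆ cellOf φ = u ⋆ insertRight p v' hv' := by
  have huα : tgt u = src α := hf.trans hα.symm
  rw [hφ huα, vcomp_eq_vcomp_assoc (vcomp_lunit_inv_of_src v hv (by simp [hv])),
    hcell_vcomp_hcell, vcomp_insertRight u hf v' hv' (by simp [hf, hv']), lunit_hid_eq_runit_hid]
  congr 1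
  exact hcell_congr (by simp) e _ _

end Calculus

end DoubleCategory

/-! ## Operations on companions -/

namespace DoubleCategory

/-! ### External composites of transposes, and the abstract form of the two swallowtails. -/

section Swallowtail

variable {D : Type u} [CellCategory.{c, p, v} D] [DoubleCategory D]

/-- The globular composite is the one in the composition axiom of an oplax transformation. -/
theorem IsTransposeCell.hcomp {x y z x' y' z' : D} {p : Pro x x'} {q : Pro y y'} {r : Pro z z'}
    {u : Cell (hid x) p} {u' : Cell (hid y) q} {u'' : Cell (hid z) r} {hu' : src u' = 𝟙 y}
    {hu'' : src u'' = 𝟙 z} {m : Pro x y} {n : Pro y z} {m' : Pro x' y'} {n' : Pro y' z'}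
    {α : Cell m m'} {β : Cell n n'} (hα : tgt u = src α) (hα' : tgt α = tgt u')
    (hβ : tgt u' = src β) {φ : m ⊙ q ⟶ p ⊙ m'}
    {ψ : n ⊙ r ⟶ q ⊙ n'} (hφ : IsTransposeCell u u' hu' α φ)
    (hψ : IsTransposeCell u' u'' hu'' β ψ) :
    IsTransposeCell u u'' hu'' (hcell α β (hα'.trans hβ)) ((assoc' m n r).hom ≫ wl m ψ ≫
      (assoc' m q n').inv ≫ wr φ n' ≫ (assoc' p m' n').hom) := fun h => by
  simp only [cellOf_comp]
  rw [vcomp_eq_assoc (insertRight_vcomp_assoc _ _ _ _ (by simp)), cellOf_wl,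
    vcomp_eq_assoc (hcell_vcomp_hcell _ _ _ _ _ _),
    hcell_congr (vid_vcomp _) (hψ hβ) _ (by simp [hu'])]
  have e₁ : hcell (vid m) (cellOf (lunit n).inv ⋆ hcell u' β hβ) (by simp [hu']) =
      cellOf (wl m (lunit n).inv) ⋆ hcell (vid m) (hcell u' β hβ) (by simp [hu']) := by
    rw [cellOf_wl, hcell_vcomp_hcell]
    exact hcell_congr (by simp) rfl _ _
  rw [e₁, vcomp_assoc,
    vcomp_eq_vcomp_assoc (hcell_assoc_inv _ _ _ (by simp [hu']) hβ (by simp [hβ]) _),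
    ← vcomp_assoc, ← cellOf_comp, wl_lunit_inv, cellOf_wr, cellOf_wr,
    vcomp_eq_assoc (hcell_vcomp_hcell _ _ _ _ _ _), vcomp_eq_assoc (hcell_vcomp_hcell _ _ _ _ _ _)]
  have e₂ : hcell ((cellOf (runit m).inv ⋆ hcell (vid m) u' (by simp [hu'])) ⋆ cellOf φ)
      ((vid n ⋆ β) ⋆ vid n') (by simp [hβ]) =
      cellOf (wr (lunit m).inv n) ⋆ hcell (hcell u α hα) β (by simp [hα', hβ]) := by
    rw [cellOf_wr, hcell_vcomp_hcell]
    exact hcell_congr (hφ hα) (by simp) _ _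
  rw [e₂, vcomp_assoc, assoc_naturality _ _ _ _ (hα'.trans hβ) _ (by simp [hα]), ← vcomp_assoc,
    ← cellOf_comp, ← lunit_hcomp_inv]

/-- Used with `cf` the companion of `η_x`, `q = (η_{GFx})_!`, `r = G (ε_{Fx})_!` and `n = GF
(η_x)_!`. The cell `τ` inserts `u'` and then `v`; the square exchanges `u'` for `w`; and `σ` removes
the inserted `w` and `v`. -/
theorem swallowtail_of_square_right {x x' z : D} {f : x ⟶ x'} (cf : Companion f)
    {q : Pro x' z} {r : Pro z x'} {u' : Cell (hid x') q}
    {hu' : src u' = 𝟙 x'} {v : Cell (hid z) r} (hv : src v = 𝟙 z) {n : Pro x' z}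
    {α : Cell cf.pro n} {φ : cf.pro ⊙ q ⟶ cf.pro ⊙ n}
    (hφ : IsTransposeCell cf.unit u' hu' α φ) (hα : src α = f) {w : Cell (hid x') n}
    (hw : src w = 𝟙 x') (e : cf.unit ⋆ α = hidCell f ⋆ w) (τ : hid x' ⟶ q ⊙ r)
    (hτ : cellOf τ = u' ⋆ insertRight q v hv) (σ : n ⊙ r ⟶ hid x')
    (hσ : w ⋆ insertRight n v hv ⋆ cellOf σ = vid (hid x')) :
    (runit cf.pro).inv ≫ wl cf.pro τ ≫ (assoc' cf.pro q r).inv ≫ wr φ r ≫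
      (assoc' cf.pro n r).hom ≫ wl cf.pro σ ≫ (runit cf.pro).hom = 𝟙 cf.pro := by
  apply unit_cancel
  simp only [cellOf_comp]
  have e₁ : cellOf (runit cf.pro).inv ⋆ cellOf (wl cf.pro τ) =
      insertRight cf.pro (u' ⋆ insertRight q v hv) (by simp [hu']) := by
    unfold insertRight
    rw [cellOf_wl]
    congr 1
    exact hcell_congr rfl hτ _ _
  rw [vcomp_eq_assoc e₁, ← insertRight_insertRight cf.pro u' hu' v hv]
  simp only [vcomp_assoc]
  rw [hom_vcomp_inv_assoc, vcomp_eq_vcomp_assoc (insertRight_vcomp_wr _ _ _)]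
  -- The leading `cf.unit`, introduced by `unit_cancel`, is what makes the exchange possible.
  have e₂ := hφ.insertRight_square cf.tgt_unit hα cf.src_unit hw e
  rw [← vcomp_assoc, ← vcomp_assoc, vcomp_assoc cf.unit, e₂, vcomp_assoc]
  have e₃ := insertRight_insertRight cf.pro w hw v hv
  have e₄ : insertRight cf.pro w hw ⋆ insertRight (cf.pro ⊙ n) v hv ⋆
      cellOf (assoc' cf.pro n r).hom ⋆ cellOf (wl cf.pro σ) ⋆ cellOf (runit cf.pro).hom =
      vid _ := by
    have := congrArg (fun γ => γ ⋆ cellOf (wl cf.pro σ) ⋆ cellOf (runit cf.pro).hom) e₃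
    simp only [vcomp_assoc] at this
    rw [this, vcomp_eq_assoc (insertRight_vcomp_wl _ _ _ _),
      insertRight_congr _ ((vcomp_assoc _ _ _).trans hσ) _ (by simp), insertRight_vid,
      inv_vcomp_hom]
  rw [e₄]
  simp

/-- Used with `cf` the companion of `ε_y`, `P = F (η_{Gy})_!`, `N = FG (ε_y)_!` and `E =
(ε_{FGy})_!`. Here the exchange of `b` for `u'` happens to the right of `P`, and `σ` then removes
`a` and `u'`, leaving the unit of `cf`. -/
theorem swallowtail_of_square_left {x y z : D} {f : x ⟶ y} (cf : Companion f) {P : Pro x z}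
    {N : Pro z x} {E : Pro z x} {a : Cell (hid x) P} {b : Cell (hid z) N} (hb : src b = 𝟙 z)
    {g : z ⟶ x} {u' : Cell (hid z) E} (hu' : src u' = 𝟙 z) (hg : tgt u' = g)
    {α : Cell N cf.pro} {φ : N ⊙ cf.pro ⟶ E ⊙ cf.pro}
    (hφ : IsTransposeCell u' cf.unit cf.src_unit α φ) (hα : src α = g)
    (e : b ⋆ α = hidCell g ⋆ cf.unit) (τ : hid x ⟶ P ⊙ N) (hτ : cellOf τ = a ⋆ insertRight P b hb)
    (σ : P ⊙ E ⟶ hid x) (hσ : a ⋆ insertRight P u' hu' ⋆ cellOf σ = vid (hid x)) :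
    (lunit cf.pro).inv ≫ wr τ cf.pro ≫ (assoc' P N cf.pro).hom ≫ wl P φ ≫
      (assoc' P E cf.pro).inv ≫ wr σ cf.pro ≫ (lunit cf.pro).hom = 𝟙 cf.pro := by
  apply unit_cancel
  simp only [cellOf_comp]
  have e₁ : cf.unit ⋆ cellOf (lunit cf.pro).inv = insertRight (hid x) cf.unit cf.src_unit := by
    have := congrArg (fun γ => γ ⋆ cellOf (lunit cf.pro).inv) (insertRight_hid cf.unit cf.src_unit)
    simpa using this.symm
  rw [vcomp_eq_assoc e₁, vcomp_eq_vcomp_assoc (insertRight_vcomp_wr _ _ _), hτ, vcomp_assoc,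
    vcomp_eq_assoc (insertRight_vcomp_assoc _ _ _ _ (by simp))]
  -- This is `insertRight_square` inside an insertion to the right of `P`.
  have e₂ : insertRight P b hb ⋆ hcell (vid P) (insertRight N cf.unit cf.src_unit) (by simp) ⋆
      cellOf (wl P φ) = insertRight P u' hu' ⋆ insertRight (P ⊙ E) cf.unit cf.src_unit ⋆
      cellOf (assoc' P E cf.pro).hom := by
    rw [insertRight_vcomp_assoc _ _ _ _ (by simp), ← vcomp_assoc,
      ← insertRight_vcomp _ _ hb _ (by simp) (by simp), insertRight_vcomp_wl,
      ← insertRight_vcomp _ _ _ _ (by simp)]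
    unfold insertRight
    congr 1
    refine hcell_congr rfl ?_ _ _
    rw [vcomp_assoc]
    exact hφ.insertRight_square hg hα hb cf.src_unit e
  have e₃ := congrArg (fun γ => a ⋆ γ ⋆ cellOf (assoc' P E cf.pro).inv ⋆ cellOf (wr σ cf.pro) ⋆
    cellOf (lunit cf.pro).hom) e₂
  simp only [vcomp_assoc] at e₃
  rw [e₃, hom_vcomp_inv_assoc, vcomp_eq_vcomp_assoc (insertRight_vcomp_wr _ _ _), insertRight_hid,
    ← vcomp_assoc, ← vcomp_assoc, vcomp_assoc a, hσ]
  simp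

end Swallowtail

end DoubleCategory

/-! ### Composite companions and companions of identities. -/

namespace Companion

section

variable {D : Type u} [CellCategory.{c, p, v} D] [DoubleCategory D]

/-- The composite of companions of composable arrows. -/
def comp {x y z : D} {f : x ⟶ y} {g : y ⟶ z} (cf : Companion f) (cg : Companion g) :
    Companion (f ≫ g) where
  pro := cf.pro ⊙ cg.pro
  unit := cf.unit ⋆ insertRight cf.pro cg.unit cg.src_unit
  counit := (hcell cf.counit (vid cg.pro) (by simp [cf.tgt_counit]) ⋆ cellOf (lunit cg.pro).hom) ⋆
    cg.counit
  src_unit := by simp [cf.src_unit]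
  tgt_unit := by simp [cf.tgt_unit, cg.tgt_unit]
  src_counit := by simp [cf.src_counit, cg.src_counit]
  tgt_counit := by simp [cg.tgt_counit]
  unit_hcell_counit h := by
    have hu : tgt cf.unit = src cf.counit := cf.tgt_unit.trans cf.src_counit.symm
    have hu' : tgt cg.unit = src cg.counit := cg.tgt_unit.trans cg.src_counit.symm
    -- Interchange separates the two companions: the factor belonging to `g` is an identity by
    -- `insertRight_hcell_counit`, and what remains is the companion equation of `f` whiskered by
    -- `cg.pro`.
    rw [hcell_vcomp cf.unit (insertRight cf.pro cg.unit cg.src_unit)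
      (hcell cf.counit (vid cg.pro) (by simp [cf.tgt_counit]) ⋆ cellOf (lunit cg.pro).hom)
      cg.counit (by simp [hu]) (by simp [hu']), vcomp_assoc, insertRight_hcell_counit, vcomp_vid]
    have e : hcell cf.unit (hcell cf.counit (vid cg.pro) (by simp [cf.tgt_counit]) ⋆
        cellOf (lunit cg.pro).hom) (by simp [hu]) =
        hcell cf.unit (hcell cf.counit (vid cg.pro) (by simp [cf.tgt_counit])) (by simp [hu]) ⋆
          cellOf (wl cf.pro (lunit cg.pro).hom) := by
      rw [cellOf_wl, hcell_vcomp_hcell]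
      exact hcell_congr (by simp) rfl _ _
    have e' := hcell_assoc_inv cf.unit cf.counit (vid cg.pro) hu (by simp [cf.tgt_counit])
      (by simp [cf.tgt_counit]) (by simp [hu])
    have e₁ := congrArg (fun γ => γ ⋆ cellOf (assoc' cf.pro (hid y) cg.pro).hom) e'
    simp only [vcomp_assoc, inv_vcomp_hom, vcomp_vid] at e₁
    rw [e, e₁, vcomp_assoc, vcomp_assoc, ← cellOf_comp, triangle_glob, cellOf_wr,
      hcell_vcomp_hcell, lunit_hcomp, cellOf_comp, cellOf_wr]
    congr 1
    exact hcell_congr (cf.unit_hcell_counit _) (by simp) _ _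
  unit_vcomp_counit := by
    -- The counit of `f` and the unit of `g` lie side by side, so their order can be swapped; each
    -- unit then meets its own counit.
    have e : insertRight cf.pro cg.unit cg.src_unit ⋆
        hcell cf.counit (vid cg.pro) (by simp [cf.tgt_counit]) ⋆ cellOf (lunit cg.pro).hom =
        cf.counit ⋆ cg.unit := by
      refine Eq.trans ?_ (congrArg (fun γ => cf.counit ⋆ γ) (insertRight_hid cg.unit cg.src_unit))
      unfold insertRight
      rw [vcomp_assoc, vcomp_assoc, vcomp_eq_vcomp_assoc
        (vcomp_runit_inv_of_tgt _ cf.tgt_counit (by simp [cf.tgt_counit]))]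
      rw [vcomp_eq_assoc (hcell_vcomp_hcell _ _ _ _ _ _),
        vcomp_eq_assoc (hcell_vcomp_hcell _ _ _ _ _ _)]
      congr 2
      exact hcell_congr (by simp) (by simp) _ _
    simp only [vcomp_assoc]
    have e' := congrArg (fun γ => cf.unit ⋆ γ ⋆ cg.counit) e
    simp only [vcomp_assoc] at e'
    rw [e', cg.unit_vcomp_counit, vcomp_eq_assoc cf.unit_vcomp_counit, hidCell_comp]

/-- A companion of an identity arrow is isomorphic to the external identity. -/
def isoHid {x : D} {f : x ⟶ x} (cf : Companion f) (hf : f = 𝟙 x) : hid x ≅ cf.pro where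
  hom := Globular.mk cf.unit cf.src_unit (cf.tgt_unit.trans hf)
  inv := Globular.mk cf.counit (cf.src_counit.trans hf) cf.tgt_counit
  hom_inv_id := glob_ext (by subst hf; exact cf.unit_vcomp_counit.trans (hidCell_id _))
  inv_hom_id := by
    -- After the unit is inserted, this too follows from `unit ⋆ counit = hidCell f` with `f` an
    -- identity.
    apply unit_cancel cf
    rw [cellOf_comp]
    refine (vcomp_eq_assoc cf.unit_vcomp_counit _).trans ?_
    subst hf
    simp

end

end Companion

/-! ### Double functors preserve insertions, transposes and companions. -/

namespace DoubleFunctor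

variable {D : Type u₁} [CellCategory.{c₁, p₁, v₁} D] [DoubleCategory D]
  {E : Type u₂} [CellCategory.{c₂, p₂, v₂} E] [DoubleCategory E] (F : DoubleFunctor D E)

/-- The image under a double functor of a cell out of an external identity. -/
def mapUnit {x y z : D} {m : Pro y z} (u : Cell (hid x) m) :
    Cell (hid (F.obj x)) (F.mapPro m) :=
  cellOf (F.mapId x).hom ⋆ F.mapCell u

@[simp] theorem src_mapUnit {x y z : D} {m : Pro y z} (u : Cell (hid x) m) :
    src (F.mapUnit u) = F.map (src u) := by
  simp [mapUnit]

@[simp] theorem tgt_mapUnit {x y z : D} {m : Pro y z} (u : Cell (hid x) m) :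
    tgt (F.mapUnit u) = F.map (tgt u) := by
  simp [mapUnit]

theorem comp_mapUnit {A : Type u₃} [CellCategory.{c₃, p₃, v₃} A] [DoubleCategory A]
    (H : DoubleFunctor E A) {x y z : D} {m : Pro y z} (v : Cell (hid x) m) :
    (F.comp H).mapUnit v = H.mapUnit (F.mapUnit v) := by
  simp [mapUnit, comp]

theorem src_mapUnit_eq_id {x y : D} {m : Pro x y} {u : Cell (hid x) m} (hu : src u = 𝟙 x) :
    src (F.mapUnit u) = 𝟙 (F.obj x) := by
  simp [hu]

theorem tgt_mapUnit_eq_src_mapCell {x y z w a : D} {m : Pro y z} {u : Cell (hid x) m}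
    {n : Pro x w} {k : Pro z a} {α : Cell n k} (h : tgt u = src α) :
    tgt (F.mapUnit u) = src (F.mapCell α) := by
  simp [h]

theorem mapCell_hcell_vcomp_inv {x y z x' y' z' : D} {m : Pro x y} {n : Pro y z} {m' : Pro x' y'}
    {n' : Pro y' z'} (α : Cell m m') (β : Cell n n') (h : tgt α = src β)
    (h' : tgt (F.mapCell α) = src (F.mapCell β)) :
    F.mapCell (hcell α β h) ⋆ cellOf (F.mapComp m' n').inv =
      cellOf (F.mapComp m n).inv ⋆ hcell (F.mapCell α) (F.mapCell β) h' := by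
  have e := congrArg (fun γ => cellOf (F.mapComp m n).inv ⋆ γ ⋆ cellOf (F.mapComp m' n').inv)
    (F.mapComp_naturality α β h h')
  simpa using e.symm

theorem mapCell_runit_inv {x y : D} (m : Pro x y) :
    F.mapGlob (runit m).inv ≫ (F.mapComp m (hid y)).inv =
      (runit (F.mapPro m)).inv ≫ wl (F.mapPro m) (F.mapId y).hom := by
  rw [Iso.eq_inv_comp, ← F.glob_runit]
  simp only [Category.assoc]
  rw [← Category.assoc (F.mapGlob _), ← F.mapGlob_comp, Iso.hom_inv_id, mapGlob_id,
    Category.id_comp, Iso.hom_inv_id, Category.comp_id]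

theorem mapCell_lunit_inv {x y : D} (m : Pro x y) :
    F.mapGlob (lunit m).inv ≫ (F.mapComp (hid x) m).inv =
      (lunit (F.mapPro m)).inv ≫ wr (F.mapId x).hom (F.mapPro m) := by
  rw [Iso.eq_inv_comp, ← F.glob_lunit]
  simp only [Category.assoc]
  rw [← Category.assoc (F.mapGlob _), ← F.mapGlob_comp, Iso.hom_inv_id, mapGlob_id,
    Category.id_comp, Iso.hom_inv_id, Category.comp_id]

theorem mapCell_insertRight {x y z : D} (m : Pro x y) {q : Pro y z} (u : Cell (hid y) q)
    (hu : src u = 𝟙 y) :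
    F.mapCell (insertRight m u hu) ⋆ cellOf (F.mapComp m q).inv =
      insertRight (F.mapPro m) (F.mapUnit u) (by simp [hu]) := by
  unfold insertRight
  rw [mapCell_vcomp, vcomp_assoc, F.mapCell_hcell_vcomp_inv _ _ _ (by simp [hu])]
  have e := congrArg cellOf (F.mapCell_runit_inv m)
  rw [cellOf_comp, cellOf_comp, cellOf_mapGlob, cellOf_wl] at e
  rw [vcomp_eq_vcomp_assoc e, hcell_vcomp_hcell]
  congr 1
  exact hcell_congr (by simp) rfl _ _

theorem mapCell_lunit_inv_vcomp {x y z x' : D} {p : Pro x x'} (u : Cell (hid x) p) {m : Pro x y}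
    {n : Pro x' z} (α : Cell m n) (h : tgt u = src α)
    (h' : tgt (F.mapUnit u) = src (F.mapCell α)) :
    F.mapCell (cellOf (lunit m).inv ⋆ hcell u α h) ⋆ cellOf (F.mapComp p n).inv =
      cellOf (lunit (F.mapPro m)).inv ⋆ hcell (F.mapUnit u) (F.mapCell α) h' := by
  rw [mapCell_vcomp, vcomp_assoc, F.mapCell_hcell_vcomp_inv _ _ _ (by simp [h])]
  have e := congrArg cellOf (F.mapCell_lunit_inv m)
  rw [cellOf_comp, cellOf_comp, cellOf_mapGlob, cellOf_wr] at e
  rw [vcomp_eq_vcomp_assoc e, hcell_vcomp_hcell]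
  congr 1
  exact hcell_congr rfl (by simp) _ _

/-- Up to comparison isomorphisms, the image of the unit of a composite companion is the unit of the
composite of the images. -/
theorem mapUnit_vcomp_insertRight {x y z w : D} {m : Pro y z} (u : Cell (hid x) m) {q : Pro z w}
    (u' : Cell (hid z) q) (hu' : src u' = 𝟙 z) :
    cellOf (F.mapId x).hom ⋆ F.mapCell (u ⋆ insertRight m u' hu') ⋆ cellOf (F.mapComp m q).inv =
      F.mapUnit u ⋆ insertRight (F.mapPro m) (F.mapUnit u') (by simp [hu']) := by
  rw [← F.mapCell_insertRight m u' hu']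
  simp [mapUnit]

/-- Supplies the hypothesis on `σ` in the first swallowtail, where `σ` is the image under `G` of an
inverse triangulator. -/
theorem mapUnit_vcomp_insertRight_vcomp_eq_vid {x z : D} {m : Pro x z} {u : Cell (hid x) m}
    {q : Pro z x} {u' : Cell (hid z) q} (hu' : src u' = 𝟙 z) {σ : m ⊙ q ⟶ hid x}
    (hσ : (u ⋆ insertRight m u' hu') ⋆ cellOf σ = vid (hid x)) :
    F.mapUnit u ⋆ insertRight (F.mapPro m) (F.mapUnit u') (F.src_mapUnit_eq_id hu') ⋆
      cellOf ((F.mapComp m q).hom ≫ F.mapGlob σ ≫ (F.mapId x).inv) = vid (hid (F.obj x)) := by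
  have e := congrArg F.mapCell hσ
  rw [mapCell_vcomp, mapCell_vid] at e
  rw [← vcomp_assoc, ← F.mapUnit_vcomp_insertRight u u' hu']
  simp only [cellOf_comp, vcomp_assoc, inv_vcomp_hom_assoc, cellOf_mapGlob]
  rw [vcomp_eq_assoc e, vid_vcomp, hom_vcomp_inv]

theorem _root_.DoubleCategory.IsTransposeCell.map {x y w z : D} {p : Pro x w} {q : Pro y z}
    {u : Cell (hid x) p} {u' : Cell (hid y) q} {hu' : src u' = 𝟙 y} {m : Pro x y} {n : Pro w z}
    {α : Cell m n} {φ : m ⊙ q ⟶ p ⊙ n} (hα : tgt u = src α)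
    (hφ : IsTransposeCell u u' hu' α φ) :
    IsTransposeCell (F.mapUnit u) (F.mapUnit u') (by simp [hu']) (F.mapCell α)
      ((F.mapComp m q).hom ≫ F.mapGlob φ ≫ (F.mapComp p n).inv) := fun h => by
  rw [← F.mapCell_insertRight m u' hu', cellOf_comp, cellOf_comp, vcomp_assoc, inv_vcomp_hom_assoc,
    cellOf_mapGlob, ← vcomp_assoc, ← mapCell_vcomp, hφ hα, mapCell_lunit_inv_vcomp]

end DoubleFunctor

namespace Companion

variable {D : Type u₁} [CellCategory.{c₁, p₁, v₁} D] [DoubleCategory D]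
  {E : Type u₂} [CellCategory.{c₂, p₂, v₂} E] [DoubleCategory E]

/-- The image of a companion under a double functor. -/
def map (F : DoubleFunctor D E) {x y : D} {f : x ⟶ y} (cf : Companion f) :
    Companion (F.map f) where
  pro := F.mapPro cf.pro
  unit := F.mapUnit cf.unit
  counit := F.mapCell cf.counit ⋆ cellOf (F.mapId y).inv
  src_unit := by simp [cf.src_unit]
  tgt_unit := by simp [cf.tgt_unit]
  src_counit := by simp [cf.src_counit]
  tgt_counit := by simp [cf.tgt_counit]
  unit_hcell_counit h := by
    have hu : tgt cf.unit = src cf.counit := cf.tgt_unit.trans cf.src_counit.symm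
    have hu' : tgt (F.mapCell cf.unit) = src (F.mapCell cf.counit) := by simp [hu]
    have e : hcell (F.mapUnit cf.unit) (F.mapCell cf.counit ⋆ cellOf (F.mapId y).inv) h =
        cellOf (wr (F.mapId x).hom (F.mapPro cf.pro)) ⋆
          hcell (F.mapCell cf.unit) (F.mapCell cf.counit) hu' ⋆
          cellOf (wl (F.mapPro cf.pro) (F.mapId y).inv) := by
      rw [cellOf_wl, cellOf_wr, hcell_vcomp_hcell, hcell_vcomp_hcell]
      exact hcell_congr (by simp [DoubleFunctor.mapUnit]) (by simp) _ _
    have e₁ : wl (F.mapPro cf.pro) (F.mapId y).inv ≫ (runit (F.mapPro cf.pro)).hom =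
        (F.mapComp cf.pro (hid y)).hom ≫ F.mapGlob (runit cf.pro).hom := by
      rw [F.glob_runit_eq, Iso.hom_inv_id_assoc]
    rw [e, vcomp_assoc, vcomp_assoc, ← cellOf_comp, e₁, cellOf_comp,
      vcomp_eq_vcomp_assoc (F.mapComp_naturality _ _ hu _), DoubleFunctor.cellOf_mapGlob,
      ← DoubleFunctor.mapCell_vcomp, cf.unit_hcell_counit, ← DoubleFunctor.cellOf_mapGlob,
      ← cellOf_comp, ← cellOf_comp, F.glob_lunit]
  unit_vcomp_counit := by
    unfold DoubleFunctor.mapUnit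
    rw [vcomp_assoc, ← vcomp_assoc (F.mapCell _), ← F.mapCell_vcomp, cf.unit_vcomp_counit,
      ← vcomp_assoc, ← F.mapId_naturality, vcomp_assoc, hom_vcomp_inv, vcomp_vid]

end Companion

/-! ## The oplax transformation of a natural transformation whose components have companions -/

namespace DoubleNatTrans

variable {D : Type u₁} [CellCategory.{c₁, p₁, v₁} D] [DoubleCategory D]
  {E : Type u₂} [CellCategory.{c₂, p₂, v₂} E] [DoubleCategory E] {F G : DoubleFunctor D E}
  (α : DoubleNatTrans F G) (comp : ∀ x, Companion (α.app x))

/-- The naturality comparison `(α_m)_! : F m ⊙ (α_y)_! ⟶ (α_x)_! ⊙ G m`. -/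
abbrev slideApp {x y : D} (m : Pro x y) :
    F.mapPro m ⊙ (comp y).pro ⟶ (comp x).pro ⊙ G.mapPro m :=
  slide (comp x) (comp y) (α.appPro m) (α.src_appPro m) (α.tgt_appPro m)

theorem isTransposeCell_slideApp {x y : D} (m : Pro x y) :
    IsTransposeCell (comp x).unit (comp y).unit (comp y).src_unit (α.appPro m)
      (α.slideApp comp m) :=
  isTransposeCell_slide _ _ _ _ _

theorem tgt_unit_eq_src_appPro {x y : D} (m : Pro x y) :
    tgt (comp x).unit = src (α.appPro m) :=
  (comp x).tgt_unit.trans (α.src_appPro m).symm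

theorem insertRight_vcomp_slideApp {x y : D} (m : Pro x y) :
    insertRight (F.mapPro m) (comp y).unit (comp y).src_unit ⋆ cellOf (α.slideApp comp m) =
      cellOf (lunit (F.mapPro m)).inv ⋆
        hcell (comp x).unit (α.appPro m) (α.tgt_unit_eq_src_appPro comp m) :=
  α.isTransposeCell_slideApp comp m _

/-- With the unit inserted, both sides paste the unit of `(α_x)_!` with the two sides of
`cell_naturality`. The next two lemmas reduce in the same way to `appPro_hid` and `appPro_hcomp`. -/
theorem slideApp_naturality {x y : D} {m n : Pro x y} (β : m ⟶ n) :
    wr (F.mapGlob β) (comp y).pro ≫ α.slideApp comp n =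
      α.slideApp comp m ≫ wl (comp x).pro (G.mapGlob β) := by
  apply insertRight_cancel
  rw [cellOf_comp, cellOf_comp, vcomp_eq_vcomp_assoc (insertRight_vcomp_wr _ _ _),
    vcomp_eq_vcomp_assoc (α.insertRight_vcomp_slideApp comp m), insertRight_vcomp_slideApp,
    vcomp_eq_vcomp_assoc (vcomp_lunit_inv_of_src _ (src_cellOf _) (by simp)), cellOf_wl,
    hcell_vcomp_hcell, hcell_vcomp_hcell]
  congr 1
  exact hcell_congr (by simp) (α.cell_naturality (cellOf β)) _ _

theorem slideApp_id (x : D) :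
    α.slideApp comp (hid x) ≫ wl (comp x).pro (G.mapId x).inv =
      wr (F.mapId x).inv (comp x).pro ≫ (lunit (comp x).pro).hom ≫ (runit (comp x).pro).inv := by
  have h : α.appPro (hid x) ⋆ cellOf (G.mapId x).inv =
      cellOf (F.mapId x).inv ⋆ hidCell (α.app x) := by
    have e := congrArg (fun γ => cellOf (F.mapId x).inv ⋆ γ ⋆ cellOf (G.mapId x).inv)
      (α.appPro_hid x)
    simpa using e
  apply insertRight_cancel
  simp only [cellOf_comp]
  rw [vcomp_eq_vcomp_assoc (insertRight_vcomp_wr _ _ _), vcomp_eq_assoc (insertRight_hid _ _),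
    vcomp_eq_vcomp_assoc (α.insertRight_vcomp_slideApp comp (hid x)), cellOf_wl,
    hcell_vcomp_hcell,
    vcomp_runit_inv (comp x).unit (comp x).tgt_unit (by simp [(comp x).tgt_unit]),
    ← lunit_hid_eq_runit_hid,
    vcomp_eq_vcomp_assoc (vcomp_lunit_inv_of_src _ (src_cellOf _) (by simp)), hcell_vcomp_hcell]
  congr 1
  exact hcell_congr (by simp) h _ _

theorem slideApp_comp {x y z : D} (m : Pro x y) (n : Pro y z) :
    α.slideApp comp (m ⊙ n) ≫ wl (comp x).pro (G.mapComp m n).inv =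
      wr (F.mapComp m n).inv (comp z).pro ≫ (assoc' _ _ _).hom ≫
        wl (F.mapPro m) (α.slideApp comp n) ≫ (assoc' _ _ _).inv ≫
        wr (α.slideApp comp m) (G.mapPro n) ≫ (assoc' _ _ _).hom := by
  have hmn : tgt (α.appPro m) = src (α.appPro n) := by rw [α.tgt_appPro, α.src_appPro]
  have h : α.appPro (m ⊙ n) ⋆ cellOf (G.mapComp m n).inv =
      cellOf (F.mapComp m n).inv ⋆ hcell (α.appPro m) (α.appPro n) hmn := by
    have e := congrArg (fun γ => cellOf (F.mapComp m n).inv ⋆ γ ⋆ cellOf (G.mapComp m n).inv)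
      (α.appPro_hcomp m n hmn)
    simpa using e
  have hc := IsTransposeCell.hcomp (α.tgt_unit_eq_src_appPro comp m)
    ((α.tgt_appPro m).trans (comp y).tgt_unit.symm) (α.tgt_unit_eq_src_appPro comp n)
    (α.isTransposeCell_slideApp comp m) (α.isTransposeCell_slideApp comp n)
    (by simpa using α.tgt_unit_eq_src_appPro comp m)
  apply insertRight_cancel
  rw [cellOf_comp, cellOf_comp, vcomp_eq_vcomp_assoc (insertRight_vcomp_wr _ _ _), hc,
    vcomp_eq_vcomp_assoc (α.insertRight_vcomp_slideApp comp (m ⊙ n)), cellOf_wl,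
    hcell_vcomp_hcell,
    vcomp_eq_vcomp_assoc (vcomp_lunit_inv_of_src _ (src_cellOf _) (by simp)), hcell_vcomp_hcell]
  congr 1
  exact hcell_congr (by simp) h _ _

/-- Naturality at a cell out of an identity, with `appPro_hid` evaluating the component there; this
is the square needed in both swallowtails. -/
theorem mapUnit_vcomp_appPro {x y z : D} {m : Pro y z} (v : Cell (hid x) m) :
    F.mapUnit v ⋆ α.appPro m = hidCell (α.app x) ⋆ G.mapUnit v := by
  unfold DoubleFunctor.mapUnit
  rw [vcomp_assoc, α.cell_naturality, vcomp_eq_vcomp_assoc (α.appPro_hid x)]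

end DoubleNatTrans

/-! ### The transposed unit and counit, the triangulators and the swallowtails. -/

namespace DoubleAdjunction

variable {D : Type u₁} [CellCategory.{c₁, p₁, v₁} D] [DoubleCategory D]
  {E : Type u₂} [CellCategory.{c₂, p₂, v₂} E] [DoubleCategory E]
  {F : DoubleFunctor D E} {G : DoubleFunctor E D} (adj : DoubleAdjunction F G)
  (unitComp : ∀ x : D, Companion (adj.unit.app x))
  (counitComp : ∀ y : E, Companion (adj.counit.app y))

/-- The oplax transformation with components the companions of the components of the unit. -/
def unitOplax : LaxAdj.Opl (Pseudofunctor.id (UBicat D))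
    (F.toPseudofunctor.comp G.toPseudofunctor) where
  app x := (unitComp x.as).pro
  naturality m := adj.unit.slideApp unitComp m
  naturality_naturality β := adj.unit.slideApp_naturality unitComp β
  naturality_id x := adj.unit.slideApp_id unitComp x.as
  naturality_comp m n := adj.unit.slideApp_comp unitComp m n

/-- The oplax transformation with components the companions of the components of the counit. -/
def counitOplax : LaxAdj.Opl (G.toPseudofunctor.comp F.toPseudofunctor)
    (Pseudofunctor.id (UBicat E)) where
  app y := (counitComp y.as).pro
  naturality n := adj.counit.slideApp counitComp n
  naturality_naturality β := adj.counit.slideApp_naturality counitComp β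
  naturality_id y := adj.counit.slideApp_id counitComp y.as
  naturality_comp m n := adj.counit.slideApp_comp counitComp m n

/-- The companion of the composite arrow `F η_x ≫ ε_{Fx}`. -/
abbrev leftCompanion (x : D) : Companion (F.map (adj.unit.app x) ≫ adj.counit.app (F.obj x)) :=
  ((unitComp x).map F).comp (counitComp (F.obj x))

/-- The companion of the composite arrow `η_{Gy} ≫ G ε_y`. -/
abbrev rightCompanion (y : E) : Companion (adj.unit.app (G.obj y) ≫ G.map (adj.counit.app y)) :=
  (unitComp (G.obj y)).comp ((counitComp y).map G)

/-- The component at `x` of the first triangulator. -/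
def leftTriangulator (x : D) : hid (F.obj x) ≅ (adj.leftCompanion unitComp counitComp x).pro :=
  (adj.leftCompanion unitComp counitComp x).isoHid (adj.left_triangle x)

/-- The component at `y` of the inverse of the second triangulator. -/
def rightTriangulator (y : E) : hid (G.obj y) ≅ (adj.rightCompanion unitComp counitComp y).pro :=
  (adj.rightCompanion unitComp counitComp y).isoHid (adj.right_triangle y)

/-- The comparison of the zigzag at `m` transposes `F η_m ⋆ ε_{Fm}`, which is an identity by
`left_triangle_pro`. -/
theorem leftTriangulator_naturality {x y : D} (m : Pro x y) :
    wl (F.mapPro m) (adj.leftTriangulator unitComp counitComp y).hom ≫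
      (assoc' _ _ _).inv ≫ wr ((F.mapComp _ _).hom ≫ F.mapGlob (adj.unit.slideApp unitComp m) ≫
        (F.mapComp _ _).inv) _ ≫ (assoc' _ _ _).hom ≫
        wl _ (adj.counit.slideApp counitComp (F.mapPro m)) ≫ (assoc' _ _ _).inv =
    ((runit (F.mapPro m)).hom ≫ (lunit (F.mapPro m)).inv) ≫
      wr (adj.leftTriangulator unitComp counitComp x).hom (F.mapPro m) := by
  have h := IsTransposeCell.comp (hu' := (counitComp (F.obj x)).src_unit)
    (F.tgt_mapUnit_eq_src_mapCell (adj.unit.tgt_unit_eq_src_appPro unitComp m))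
    (adj.counit.tgt_unit_eq_src_appPro counitComp (F.mapPro m))
    ((adj.unit.isTransposeCell_slideApp unitComp m).map F
      (adj.unit.tgt_unit_eq_src_appPro unitComp m))
    (adj.counit.isTransposeCell_slideApp counitComp (F.mapPro m))
  -- The underlying cell of the triangulator is by definition the unit of the composite companion.
  exact isTransposeCell_globular (adj.left_triangle_pro m) h _ _ rfl rfl

theorem rightTriangulator_naturality {x y : E} (n : Pro x y) :
    wl (G.mapPro n) (adj.rightTriangulator unitComp counitComp y).hom ≫
      (assoc' _ _ _).inv ≫ wr (adj.unit.slideApp unitComp (G.mapPro n)) _ ≫ (assoc' _ _ _).hom ≫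
        wl _ ((G.mapComp _ _).hom ≫ G.mapGlob (adj.counit.slideApp counitComp n) ≫
          (G.mapComp _ _).inv) ≫ (assoc' _ _ _).inv =
    ((runit (G.mapPro n)).hom ≫ (lunit (G.mapPro n)).inv) ≫
      wr (adj.rightTriangulator unitComp counitComp x).hom (G.mapPro n) := by
  have h := IsTransposeCell.comp (hu' := G.src_mapUnit_eq_id (counitComp x).src_unit)
    (adj.unit.tgt_unit_eq_src_appPro unitComp (G.mapPro n))
    (G.tgt_mapUnit_eq_src_mapCell (adj.counit.tgt_unit_eq_src_appPro counitComp n))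
    (adj.unit.isTransposeCell_slideApp unitComp (G.mapPro n))
    ((adj.counit.isTransposeCell_slideApp counitComp n).map G
      (adj.counit.tgt_unit_eq_src_appPro counitComp n))
  exact isTransposeCell_globular (adj.right_triangle_pro n) h _ _ rfl rfl

theorem swallowtail_unit (x : D) :
    (runit (unitComp x).pro).inv ≫
      wl (unitComp x).pro (adj.rightTriangulator unitComp counitComp (F.obj x)).hom ≫
      (assoc' _ _ _).inv ≫
      wr (adj.unit.slideApp unitComp (unitComp x).pro) (G.mapPro (counitComp (F.obj x)).pro) ≫
      (assoc' _ _ _).hom ≫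
      wl (unitComp x).pro ((G.mapComp (F.mapPro (unitComp x).pro) (counitComp (F.obj x)).pro).hom ≫
        G.mapGlob (adj.leftTriangulator unitComp counitComp x).inv ≫ (G.mapId (F.obj x)).inv) ≫
      (runit (unitComp x).pro).hom = 𝟙 (unitComp x).pro := by
  refine swallowtail_of_square_right (unitComp x)
    (v := G.mapUnit (counitComp (F.obj x)).unit) (G.src_mapUnit_eq_id (counitComp (F.obj x)).src_unit)
    (adj.unit.isTransposeCell_slideApp unitComp (unitComp x).pro) (adj.unit.src_appPro _)
    (w := G.mapUnit (F.mapUnit (unitComp x).unit)) (G.src_mapUnit_eq_id (F.src_mapUnit_eq_id (unitComp x).src_unit))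
    ?_ _ rfl _ ?_
  -- The domain of `η` is the identity double functor, whose `mapUnit` only composes with an
  -- identity cell.
  · have e := adj.unit.mapUnit_vcomp_appPro (unitComp x).unit
    rw [DoubleFunctor.comp_mapUnit] at e
    refine Eq.trans ?_ e
    congr 1
    exact (vid_vcomp _).symm
  · exact G.mapUnit_vcomp_insertRight_vcomp_eq_vid (counitComp (F.obj x)).src_unit
      (congrArg cellOf (adj.leftTriangulator unitComp counitComp x).hom_inv_id)

theorem swallowtail_counit (y : E) :
    (lunit (counitComp y).pro).inv ≫
      wr ((F.mapId (G.obj y)).hom ≫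
        F.mapGlob (adj.rightTriangulator unitComp counitComp y).hom ≫
        (F.mapComp (unitComp (G.obj y)).pro (G.mapPro (counitComp y).pro)).inv)
        (counitComp y).pro ≫
      (assoc' _ _ _).hom ≫
      wl (F.mapPro (unitComp (G.obj y)).pro)
        (adj.counit.slideApp counitComp (counitComp y).pro) ≫
      (assoc' _ _ _).inv ≫
      wr (adj.leftTriangulator unitComp counitComp (G.obj y)).inv (counitComp y).pro ≫
      (lunit (counitComp y).pro).hom = 𝟙 (counitComp y).pro := by
  refine swallowtail_of_square_left (counitComp y)
    (a := F.mapUnit (unitComp (G.obj y)).unit)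
    (b := F.mapUnit (G.mapUnit (counitComp y).unit)) (F.src_mapUnit_eq_id (G.src_mapUnit_eq_id (counitComp y).src_unit))
    (counitComp (F.obj (G.obj y))).src_unit (counitComp (F.obj (G.obj y))).tgt_unit
    (adj.counit.isTransposeCell_slideApp counitComp (counitComp y).pro) (adj.counit.src_appPro _)
    ?_ _ ?_ _ ?_
  · have e := adj.counit.mapUnit_vcomp_appPro (counitComp y).unit
    rw [DoubleFunctor.comp_mapUnit] at e
    refine e.trans ?_
    congr 1
    exact vid_vcomp _
  · exact F.mapUnit_vcomp_insertRight (unitComp (G.obj y)).unit (G.mapUnit (counitComp y).unit)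
      (G.src_mapUnit_eq_id (counitComp y).src_unit)
  · exact (vcomp_assoc _ _ _).symm.trans
      (congrArg cellOf (adj.leftTriangulator unitComp counitComp (G.obj y)).hom_inv_id)

section

open scoped Oplax.OplaxTrans

/-- The first triangulator. -/
def leftModification : 𝟙 F.toPseudofunctor.toOplax ≅
    LaxAdj.leftZigzag (adj.unitOplax unitComp) (adj.counitOplax counitComp) :=
  Oplax.OplaxTrans.isoMk (η := 𝟙 F.toPseudofunctor.toOplax)
    (θ := LaxAdj.leftZigzag (adj.unitOplax unitComp) (adj.counitOplax counitComp))
    (fun x => adj.leftTriangulator unitComp counitComp x.as)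
    (fun m => adj.leftTriangulator_naturality unitComp counitComp m)

/-- The inverse of the second triangulator. -/
def rightModification : 𝟙 G.toPseudofunctor.toOplax ≅
    LaxAdj.rightZigzag (adj.unitOplax unitComp) (adj.counitOplax counitComp) :=
  Oplax.OplaxTrans.isoMk (η := 𝟙 G.toPseudofunctor.toOplax)
    (θ := LaxAdj.rightZigzag (adj.unitOplax unitComp) (adj.counitOplax counitComp))
    (fun y => adj.rightTriangulator unitComp counitComp y.as)
    (fun n => adj.rightTriangulator_naturality unitComp counitComp n)

/-- The lax adjunction between underlying bicategories. -/
def laxAdjunction : LaxAdjunction F.toPseudofunctor G.toPseudofunctor where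
  unit := adj.unitOplax unitComp
  counit := adj.counitOplax counitComp
  s := adj.leftModification unitComp counitComp
  -- The companion construction gives a cell out of the identity, so it yields `t⁻¹`, the direction
  -- that the swallowtails use.
  t := (adj.rightModification unitComp counitComp).symm
  swallowtail_unit x := adj.swallowtail_unit unitComp counitComp x.as
  swallowtail_counit y := adj.swallowtail_counit unitComp counitComp y.as

end

end DoubleAdjunction

theorem mainTheorem9 {D : Type u₁} [CellCategory.{c₁, p₁, v₁} D] [DoubleCategory D]
    {E : Type u₂} [CellCategory.{c₂, p₂, v₂} E] [DoubleCategory E]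
    (F : DoubleFunctor D E) (G : DoubleFunctor E D) (adj : DoubleAdjunction F G)
    (unitComp : ∀ x : D, Companion (adj.unit.app x))
    (counitComp : ∀ y : E, Companion (adj.counit.app y)) :
    ∃ A : LaxAdjunction F.toPseudofunctor G.toPseudofunctor,
      adj.unit.IsTranspose unitComp (fun x => A.unit.app ⟨x⟩)
        (fun {x y} m => A.unit.naturality (a := ⟨x⟩) (b := ⟨y⟩) m) ∧
      adj.counit.IsTranspose counitComp (fun y => A.counit.app ⟨y⟩)
        (fun {x y} n => A.counit.naturality (a := ⟨x⟩) (b := ⟨y⟩) n) ∧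
      (adj.unit.HasCommuterCells unitComp → adj.counit.HasCommuterCells counitComp →
        A.IsBiadjunction) := by
  -- The components are the chosen companions by definition, so every `eqToHom` is an identity. A
  -- commuter is by definition an invertible `slide`, which is the comparison itself.
  refine ⟨adj.laxAdjunction unitComp counitComp, ⟨fun _ => rfl, fun {x y} m => ?_⟩,
    ⟨fun _ => rfl, fun {x y} n => ?_⟩, fun hη hε => ⟨fun m => hη m, fun n => hε n⟩⟩
  · have e : adj.unit.slideApp unitComp m ≫ wr (𝟙 _) _ =
        wl _ (𝟙 _) ≫ adj.unit.slideApp unitComp m := by simp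
    exact e
  · have e : adj.counit.slideApp counitComp n ≫ wr (𝟙 _) _ =
        wl _ (𝟙 _) ≫ adj.counit.slideApp counitComp n := by simp
    exact e
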